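/- A \emph{2-complex} $K$ (in a Hausdorff space) consists of a finite set $V(K)$ of points (vertices), a finite set $E(K)$ of edges, each homeomorphic to the unit interval and having two distinct vertices as its endpoints, and a finite set $F(K)$ of faces, each homeomorphic to a closed $n$-gon for some $n\ge 3$ in such a way that the sides of the $n$-gon correspond to distinct edges in $E(K)$; the interiors of distinct cells (vertices, edges, faces) are disjoint. $K$ is regarded as a topological space, the union of its cells. The degree of an edge is the number of faces containing it, and $K$ is \emph{even} if every edge of $K$ has positive even degree. A \emph{circlet} is an even 2-complex with at least one face that is not a face-disjoint union of two even 2-complexes having at least one face each. A \emph{cellular map} $M\to K$ is a continuous map of 2-complexes whose restriction to any $k$-cell of $M$ is a homeomorphism onto a $k$-cell of $K$, for $k=0,1,2$. An \emph{Euler cover} of $K$ is a cellular map $\varphi\colon M\to K$, where $M$ is a 2-complex whose underlying space is a connected surface (each point has a neighborhood homeomorphic to an open disk), such that each face of $K$ is the image under $\varphi$ of exactly one face of $M$. \textbf{Proposition.} Every circlet $K$ has an Euler cover $M\to K$. -/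

import Mathlib

open Set Topology

universe u

/-- The closed regular `n`-gon in the plane `ℝ² = ℂ` (for `n ≥ 3`), circumscribed about the unit
circle: the intersection of the `n` half-planes `x cos (2πk/n) + y sin (2πk/n) ≤ 1`. -/
def regularPolygon (n : ℕ) : Set ℂ :=
  {z | ∀ k : Fin n, z.re * Real.cos (2 * Real.pi * (k : ℕ) / n)
    + z.im * Real.sin (2 * Real.pi * (k : ℕ) / n) ≤ 1}

/-- The `k`-th side of the regular `n`-gon: the part of it on its `k`-th bounding line. -/
def polygonSide (n : ℕ) (k : Fin n) : Set ℂ :=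
  {z | z ∈ regularPolygon n ∧ z.re * Real.cos (2 * Real.pi * (k : ℕ) / n)
    + z.im * Real.sin (2 * Real.pi * (k : ℕ) / n) = 1}

/-- A 2-complex in a (Hausdorff) space `X`: finite sets of vertices, edges and faces. An edge is
homeomorphic to the unit interval, a face to a closed polygon whose sides are edges, and the
interiors of distinct cells do not meet. -/
structure TwoComplex (X : Type u) [TopologicalSpace X] where
  /-- The vertices (0-cells). -/
  V : Set X
  /-- The (closed) edges (1-cells). -/
  E : Set (Set X)
  /-- The (closed) faces (2-cells). -/
  F : Set (Set X)
  finite_V : V.Finite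
  finite_E : E.Finite
  finite_F : F.Finite
  /-- An edge is homeomorphic to `[0, 1]`. Its endpoints (which are distinct, since the
  homeomorphism is injective) are vertices, and there are no vertices in its interior. -/
  edge_cell : ∀ e ∈ E, ∃ h : ℝ → X, IsEmbedding ((Icc (0 : ℝ) 1).domRestrict h) ∧
    h '' Icc (0 : ℝ) 1 = e ∧ ∀ t ∈ Icc (0 : ℝ) 1, (h t ∈ V ↔ t = 0 ∨ t = 1)
  /-- Distinct edges have disjoint interiors. -/
  edge_inter : ∀ e ∈ E, ∀ e' ∈ E, e ≠ e' → e ∩ e' ⊆ V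
  /-- A face is homeomorphic to a closed `n`-gon, `n ≥ 3`. The sides are edges (and distinct ones,
  since the homeomorphism is injective), and no vertex or edge meets the interior. -/
  face_cell : ∀ f ∈ F, ∃ n : ℕ, 3 ≤ n ∧ ∃ h : ℂ → X, IsEmbedding ((regularPolygon n).domRestrict h) ∧
    h '' regularPolygon n = f ∧ (∀ k : Fin n, h '' polygonSide n k ∈ E) ∧
    ∀ z ∈ regularPolygon n, h z ∈ V ∪ ⋃₀ E → ∃ k : Fin n, z ∈ polygonSide n k
  /-- Distinct faces have disjoint interiors. -/
  face_inter : ∀ f ∈ F, ∀ f' ∈ F, f ≠ f' → f ∩ f' ⊆ V ∪ ⋃₀ E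

namespace TwoComplex

variable {X Y : Type u} [TopologicalSpace X] [TopologicalSpace Y]

/-- The underlying space: the union of all cells, with the topology induced from `X`. -/
def carrier (K : TwoComplex X) : Set X := K.V ∪ ⋃₀ K.E ∪ ⋃₀ K.F

/-- The degree of an edge: the number of faces to which it belongs. -/
noncomputable def degree (K : TwoComplex X) (e : Set X) : ℕ := {f ∈ K.F | e ⊆ f}.ncard

/-- A 2-complex is even if each of its edges has positive even degree. -/
def IsEven (K : TwoComplex X) : Prop := ∀ e ∈ K.E, 0 < K.degree e ∧ Even (K.degree e)

/-- `K` is the face-disjoint union of the 2-complexes `A` and `B`. -/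
def IsFaceDisjointUnion (K A B : TwoComplex X) : Prop :=
  A.V ∪ B.V = K.V ∧ A.E ∪ B.E = K.E ∧ A.F ∪ B.F = K.F ∧ Disjoint A.F B.F

/-- A circlet: an even 2-complex (with at least one face) that is not a face-disjoint union of two
even 2-complexes, each with at least one face. -/
def IsCirclet (K : TwoComplex X) : Prop :=
  K.IsEven ∧ K.F.Nonempty ∧
    ¬ ∃ A B : TwoComplex X, A.IsEven ∧ B.IsEven ∧ A.F.Nonempty ∧ B.F.Nonempty ∧
      K.IsFaceDisjointUnion A B

/-- A 2-complex is a surface if each point of its underlying space has an open neighborhood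
homeomorphic to an open disk. -/
def IsSurface (M : TwoComplex X) : Prop :=
  ∀ x : M.carrier, ∃ U : Set M.carrier, IsOpen U ∧ x ∈ U ∧
    Nonempty (U ≃ₜ Metric.ball (0 : ℂ) 1)

/-- A cellular map from `M` to `K`: a continuous map on the underlying space of `M` whose
restriction to each `k`-cell of `M` is a homeomorphism onto a `k`-cell of `K`, `k = 0, 1, 2`.
(The values of `φ` off the underlying space of `M` play no role.) -/
structure IsCellularMap (M : TwoComplex Y) (K : TwoComplex X) (φ : Y → X) : Prop where
  continuousOn : ContinuousOn φ M.carrier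
  vertex : ∀ v ∈ M.V, φ v ∈ K.V
  edge : ∀ e ∈ M.E, φ '' e ∈ K.E ∧ IsEmbedding (e.domRestrict φ)
  face : ∀ f ∈ M.F, φ '' f ∈ K.F ∧ IsEmbedding (f.domRestrict φ)

/-- An Euler cover of `K`: a cellular map to `K` from a connected surface `M` such that each face
of `K` is the image of exactly one face of `M`. -/
structure IsEulerCover (M : TwoComplex Y) (K : TwoComplex X) (φ : Y → X) : Prop where
  isSurface : M.IsSurface
  isConnected : IsConnected M.carrier
  isCellularMap : IsCellularMap M K φ
  existsUnique_face : ∀ g ∈ K.F, ∃! f, f ∈ M.F ∧ φ '' f = g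

end TwoComplex

/-!
The surface is built from the flags (face, edge, vertex) of the circlet `K`. Each edge has even
degree, so the faces at each edge can be arranged in pairs. This gives three fixed-point-free
involutions on the flags: `s 0` changes the vertex, `s 1` changes the edge within the face at the
same vertex, and `s 2` passes to the other face of the pair at the edge. Take one triangle for each
flag, with barycentric coordinates `x 0, x 1, x 2`, and glue the triangle of `φ` to that of `s i φ`
along the wall `x i = 0` (`FlagSystem.Realization`): this is the barycentric subdivision of the
surface in which the faces of `K` are glued along the chosen pairs.

* The result is a closed surface, for any three such involutions on a finite set
  (`FlagSystem.exists_disk_nhd`): every point lies in the open star `x i > 0` of a corner, the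
  triangles around this corner form an orbit of the two other involutions, such an orbit is a cycle
  (`FlagSystem.exists_cycle`), and the open cone over a cycle is a disk. Vertices, edges and faces
  need no separate treatment.
* It maps to `K` (`TwoComplex.develop`): a face of `K` is parametrized by a polygon, which is the
  cone from its centre over its boundary, and the boundary is divided into half-edges, one for each
  flag. The half-edges are parametrized in `K`, independently of the faces, so the maps agree along
  the walls. On the triangles of one face, the map identifies only points that are glued
  (`TwoComplex.IsCompatible.eq_and_joined_of_develop_eq`), so each face is embedded, and the
  cells of the surface inherit their parametrizations from `K`.
* It is connected (`TwoComplex.IsCompatible.joined_of_isCirclet`): the faces in one component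
  include with each face also its partners, so they form an even complex, as do the remaining faces.
  Since `K` is a circlet, no faces remain. In particular, any choice of the pairs will do.
-/

/-! ### Flag systems and their realizations -/

/-- The combinatorial data of a closed surface glued from triangles: a type of flags with three
fixed-point-free involutions. In the flag system of a cell decomposition, the involution `s i`
changes the `i`-dimensional member of a flag and keeps the two others. (There `s 0` and `s 2`
commute; this is not needed for the gluing to be a surface, so it is not required here.) -/
structure FlagSystem (Φ : Type u) where
  /-- The involution that changes the `i`-dimensional member. -/
  s : Fin 3 → Φ → Φ
  invol : ∀ i φ, s i (s i φ) = φ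
  ne : ∀ i φ, s i φ ≠ φ

namespace FlagSystem

variable {Φ : Type u} (G : FlagSystem Φ)

/-- Two flags are joined over `S` if they lie in one orbit of the group generated by the
involutions `s i`, `i ∈ S`. -/
def Joined (S : Set (Fin 3)) : Φ → Φ → Prop :=
  Relation.ReflTransGen fun φ ψ => ∃ i ∈ S, ψ = G.s i φ

variable {G}

theorem Joined.refl {S : Set (Fin 3)} (φ : Φ) : G.Joined S φ φ := Relation.ReflTransGen.refl

theorem Joined.trans {S : Set (Fin 3)} {φ ψ χ : Φ} (h : G.Joined S φ ψ) (h' : G.Joined S ψ χ) :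
    G.Joined S φ χ := Relation.ReflTransGen.trans h h'

theorem Joined.step {S : Set (Fin 3)} {i : Fin 3} (hi : i ∈ S) (φ : Φ) :
    G.Joined S φ (G.s i φ) := Relation.ReflTransGen.single ⟨i, hi, rfl⟩

theorem Joined.symm {S : Set (Fin 3)} {φ ψ : Φ} (h : G.Joined S φ ψ) : G.Joined S ψ φ := by
  induction h with
  | refl => exact .refl _
  | @tail χ _ _ h ih =>
    obtain ⟨i, hi, rfl⟩ := h
    have h := Joined.step (G := G) hi (G.s i χ)
    rw [G.invol] at h
    exact h.trans ih

theorem Joined.mono {S T : Set (Fin 3)} (hST : S ⊆ T) {φ ψ : Φ} (h : G.Joined S φ ψ) :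
    G.Joined T φ ψ :=
  Relation.ReflTransGen.mono (fun _ _ ⟨i, hi, h⟩ => ⟨i, hST hi, h⟩) _ _ h

/-- A function that is invariant under the involutions in `S` is constant on joined flags. -/
theorem Joined.map_eq {α : Type*} {S : Set (Fin 3)} {φ ψ : Φ} (h : G.Joined S φ ψ) (m : Φ → α)
    (hm : ∀ i ∈ S, ∀ χ, m (G.s i χ) = m χ) : m ψ = m φ := by
  induction h with
  | refl => rfl
  | tail _ h ih =>
    obtain ⟨i, hi, rfl⟩ := h
    rw [hm i hi, ih]

variable (G)

/-- The relation that glues the triangles `{φ} × Δ`, `φ ∈ Φ`, along their walls: the point `x` of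
the triangle of `φ` is identified with the point `x` of the triangle of `s i φ` if `x i = 0`. -/
def gluing : Setoid (Φ × stdSimplex ℝ (Fin 3)) where
  r p q := p.2 = q.2 ∧ G.Joined {i | p.2 i = 0} p.1 q.1
  iseqv :=
    { refl := fun _ => ⟨rfl, .refl _⟩
      symm := fun {_ _} h => ⟨h.1.symm, h.1 ▸ h.2.symm⟩
      trans := fun {_ _ _} h h' => ⟨h.1.trans h'.1, h.2.trans (by rw [h.1]; exact h'.2)⟩ }

/-- The space obtained from one triangle for each flag by gluing along the involutions. The
corners `x i = 1` of the triangles become the barycentres of the `i`-dimensional cells. -/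
def Realization : Type u := Quotient G.gluing

/-- The image of the point `x` of the triangle of the flag `φ`. -/
def proj (p : Φ × stdSimplex ℝ (Fin 3)) : G.Realization := Quotient.mk G.gluing p

theorem proj_surjective : Function.Surjective G.proj := Quotient.mk_surjective

theorem proj_eq_iff {p q : Φ × stdSimplex ℝ (Fin 3)} :
    G.proj p = G.proj q ↔ p.2 = q.2 ∧ G.Joined {i | p.2 i = 0} p.1 q.1 := Quotient.eq

variable [TopologicalSpace Φ]

instance : TopologicalSpace G.Realization := inferInstanceAs (TopologicalSpace (Quotient _))

theorem isQuotientMap_proj : IsQuotientMap G.proj := isQuotientMap_quot_mk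

theorem continuous_proj : Continuous G.proj := G.isQuotientMap_proj.continuous

theorem continuous_coord (i : Fin 3) : Continuous fun x : stdSimplex ℝ (Fin 3) => x i :=
  (continuous_apply i).comp continuous_subtype_val

open scoped Classical in
/-- The barycentric coordinates of a point, together with the functions `F S ψ` that take the value
`∏ i ∉ S, x i` on the triangles joined to `ψ` over `S` and vanish elsewhere, separate points. -/
instance [DiscreteTopology Φ] : T2Space G.Realization := by
  let g : Φ × stdSimplex ℝ (Fin 3) → stdSimplex ℝ (Fin 3) × (Set (Fin 3) × Φ → ℝ) :=
    fun p => (p.2, fun a => if G.Joined a.1 a.2 p.1 then ∏ i with i ∉ a.1, p.2 i else 0)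
  have hg : Continuous g := by
    refine continuous_snd.prodMk (continuous_pi fun a => ?_)
    rw [continuous_prod_of_discrete_left]
    intro φ
    by_cases h : G.Joined a.1 a.2 φ
    · simp only [h, if_true]
      exact continuous_finsetProd _ fun i _ => continuous_coord i
    · simp only [h, if_false]
      exact continuous_const
  have hwd : ∀ p q, G.gluing p q → g p = g q := by
    rintro ⟨φ, x⟩ ⟨ψ, y⟩ ⟨rfl, h⟩
    refine Prod.ext rfl (funext fun a => ?_)
    simp only [g] at h ⊢
    induction h with
    | refl => rfl
    | @tail χ _ _ h ih =>
      obtain ⟨i, hi, rfl⟩ := h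
      rw [ih]
      by_cases hia : i ∈ a.1
      · have : G.Joined a.1 a.2 χ ↔ G.Joined a.1 a.2 (G.s i χ) :=
          ⟨fun h => h.trans (.step hia _), fun h => h.trans (Joined.step hia _).symm⟩
        simp only [this]
      · have h0 : ∏ i with i ∉ a.1, x i = 0 :=
          Finset.prod_eq_zero (Finset.mem_filter.2 ⟨Finset.mem_univ i, hia⟩) hi
        simp [h0]
  refine T2Space.of_injective_continuous (f := (Quotient.lift g hwd : G.Realization → _)) ?_
    (Continuous.quotient_lift hg hwd)
  intro a b
  obtain ⟨⟨φ, x⟩, rfl⟩ := G.proj_surjective a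
  obtain ⟨⟨ψ, y⟩, rfl⟩ := G.proj_surjective b
  intro h
  have h : g (φ, x) = g (ψ, y) := h
  have hxy : x = y := congrArg Prod.fst h
  subst hxy
  have h2 := congrFun (congrArg Prod.snd h) ({i | x i = 0}, φ)
  refine G.proj_eq_iff.2 ⟨rfl, ?_⟩
  by_contra hne
  simp only [g, Joined.refl, if_true] at h2
  rw [if_neg hne, Finset.prod_eq_zero_iff] at h2
  obtain ⟨i, hi, hi'⟩ := h2
  exact (Finset.mem_filter.1 hi).2 hi'

theorem exists_coord_eq_zero (i : Fin 3) : ∃ x : stdSimplex ℝ (Fin 3), x i = 0 := by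
  refine ⟨⟨Pi.single (i + 1) 1, single_mem_stdSimplex ℝ (i + 1)⟩, ?_⟩
  change (Pi.single (i + 1) 1 : Fin 3 → ℝ) i = 0
  rw [Pi.single_eq_of_ne]
  fin_cases i <;> decide

theorem isConnected_univ [Nonempty Φ] (hG : ∀ φ ψ, G.Joined univ φ ψ) :
    IsConnected (univ : Set G.Realization) := by
  have hU : (univ : Set G.Realization) = ⋃ φ : Φ, range fun x => G.proj (φ, x) := by
    refine (eq_univ_of_forall fun y => ?_).symm
    obtain ⟨⟨φ, x⟩, rfl⟩ := G.proj_surjective y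
    exact mem_iUnion.2 ⟨φ, x, rfl⟩
  rw [hU]
  refine IsConnected.iUnion_of_reflTransGen
    (fun φ => isConnected_range (G.continuous_proj.comp (Continuous.prodMk_right φ))) fun φ ψ => ?_
  refine Relation.ReflTransGen.mono ?_ _ _ (hG φ ψ)
  rintro φ ψ ⟨i, -, rfl⟩
  obtain ⟨x, hx⟩ := exists_coord_eq_zero i
  have h : G.proj (φ, x) = G.proj (G.s i φ, x) := G.proj_eq_iff.2 ⟨rfl, .step (by exact hx) _⟩
  exact ⟨G.proj (φ, x), ⟨x, rfl⟩, x, h.symm⟩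

end FlagSystem

/-! ### Cones over curves -/

/-- The cone over the curve `γ : [0, 1] → ℂ`, in homogeneous coordinates: the point with
coordinates `(a, b)`, `a, b ≥ 0`, is at the multiple `a + b` of the point `γ (b / (a + b))`. -/
noncomputable def cone (γ : ℝ → ℂ) (a b : ℝ) : ℂ := ((a + b : ℝ) : ℂ) * γ (b / (a + b))

theorem div_add_mem_Icc {a b : ℝ} (ha : 0 ≤ a) (hb : 0 ≤ b) : b / (a + b) ∈ Icc (0 : ℝ) 1 :=
  ⟨by positivity, div_le_one_of_le₀ (by linarith) (by linarith)⟩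

theorem continuousOn_cone {γ : ℝ → ℂ} (hγ : ContinuousOn γ (Icc 0 1)) :
    ContinuousOn (fun p : ℝ × ℝ => cone γ p.1 p.2) (Ici 0 ×ˢ Ici 0) := by
  rintro ⟨a, b⟩ ⟨ha, hb⟩
  simp only [mem_Ici] at ha hb
  have hmaps : MapsTo (fun p : ℝ × ℝ => p.2 / (p.1 + p.2)) (Ici 0 ×ˢ Ici 0) (Icc 0 1) :=
    fun p hp => div_add_mem_Icc hp.1 hp.2
  have hsum : Continuous fun p : ℝ × ℝ => ((p.1 + p.2 : ℝ) : ℂ) := by fun_prop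
  by_cases hab : a + b = 0
  · -- at the apex, `γ` is bounded and the factor `a + b` tends to zero
    obtain ⟨C, hC⟩ := isCompact_Icc.exists_bound_of_continuousOn hγ
    have h0 : cone γ a b = 0 := by simp [cone, hab]
    rw [ContinuousWithinAt, h0]
    have hlim : Filter.Tendsto (fun p : ℝ × ℝ => ‖((p.1 + p.2 : ℝ) : ℂ)‖ * C)
        (𝓝[Ici 0 ×ˢ Ici 0] (a, b)) (𝓝 0) := by
      have h : Continuous fun p : ℝ × ℝ => ‖((p.1 + p.2 : ℝ) : ℂ)‖ * C :=
        hsum.norm.mul continuous_const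
      have h1 := (h.tendsto (a, b)).mono_left (nhdsWithin_le_nhds (s := Ici 0 ×ˢ Ici 0))
      simpa [hab] using h1
    refine squeeze_zero_norm' ?_ hlim
    filter_upwards [self_mem_nhdsWithin] with p hp
    rw [cone, norm_mul]
    exact mul_le_mul_of_nonneg_left (hC _ (hmaps hp)) (norm_nonneg _)
  · refine ContinuousWithinAt.mul hsum.continuousWithinAt ?_
    refine ContinuousWithinAt.comp (t := Icc 0 1) (hγ _ (hmaps (x := (a, b)) ⟨ha, hb⟩)) ?_ hmaps
    have h1 : ContinuousAt (fun p : ℝ × ℝ => p.2 / (p.1 + p.2)) (a, b) :=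
      ContinuousAt.div (by fun_prop) (by fun_prop) hab
    exact h1.continuousWithinAt

namespace FlagSystem

theorem continuous_cone_coord {γ : ℝ → ℂ} (hγ : ContinuousOn γ (Icc 0 1)) (j k : Fin 3) :
    Continuous fun x : stdSimplex ℝ (Fin 3) => cone γ (x j) (x k) :=
  (continuousOn_cone hγ).comp_continuous ((continuous_coord j).prodMk (continuous_coord k))
    fun x => ⟨x.2.1 j, x.2.1 k⟩

/-- The three indices of a triangle, in some order. -/
structure IsTriple (i j k : Fin 3) : Prop where
  ij : i ≠ j
  ik : i ≠ k
  jk : j ≠ k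

namespace IsTriple

variable {i j k : Fin 3}

theorem cases (h : IsTriple i j k) (l : Fin 3) : l = i ∨ l = j ∨ l = k := by
  obtain ⟨h1, h2, h3⟩ := h
  omega

theorem sum_eq (h : IsTriple i j k) (x : stdSimplex ℝ (Fin 3)) : x i + x j + x k = 1 := by
  have hx : x 0 + x 1 + x 2 = 1 := by
    have := stdSimplex.sum_eq_one x
    rwa [Fin.sum_univ_three] at this
  obtain ⟨h1, h2, h3⟩ := h
  fin_cases i <;> fin_cases j <;> fin_cases k <;> simp at h1 h2 h3 <;> simp <;> linarith

theorem ext (h : IsTriple i j k) {x y : stdSimplex ℝ (Fin 3)} (hj : x j = y j) (hk : x k = y k) :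
    x = y := by
  have hi : x i = y i := by linarith [h.sum_eq x, h.sum_eq y]
  refine stdSimplex.ext (funext fun l => ?_)
  rcases h.cases l with rfl | rfl | rfl <;> assumption

theorem exists_point (h : IsTriple i j k) {a b : ℝ} (ha : 0 ≤ a) (hb : 0 ≤ b) (hab : a + b ≤ 1) :
    ∃ x : stdSimplex ℝ (Fin 3), x i = 1 - (a + b) ∧ x j = a ∧ x k = b := by
  obtain ⟨h1, h2, h3⟩ := h
  let v : Fin 3 → ℝ := fun l => if l = j then a else if l = k then b else 1 - (a + b)
  have vi : v i = 1 - (a + b) := by simp [v, h1, h2]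
  have vj : v j = a := by simp [v]
  have vk : v k = b := by simp [v, h3.symm]
  refine ⟨⟨v, fun l => ?_, ?_⟩, vi, vj, vk⟩
  · simp only [v]
    split_ifs <;> linarith
  · have : v i + v j + v k = 1 := by rw [vi, vj, vk]; ring
    rw [Fin.sum_univ_three]
    clear_value v
    fin_cases i <;> fin_cases j <;> fin_cases k <;> simp at h1 h2 h3 <;> simp at this <;> linarith

end IsTriple

variable {Φ : Type u} {G : FlagSystem Φ} {i j k : Fin 3}

/-- The kernel of the cone over a family of curves, one for each flag of an orbit `O` of
`⟨s j, s k⟩`: if each ray meets the curves in at most one point, and the curves meet only in their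
endpoints, that of `φ` meeting that of `s k φ` at parameter `0` and that of `s j φ` at parameter
`1`, then the cone map identifies only points that are glued. -/
theorem eq_and_joined_of_cone_eq (h : IsTriple i j k) {O : Set Φ} {γ : Φ → ℝ → ℂ}
    (hO : ∀ φ ∈ O, ∀ ψ ∈ O, G.Joined {j, k} φ ψ)
    (hrad : ∀ φ ∈ O, ∀ ψ ∈ O, ∀ t ∈ Icc (0 : ℝ) 1, ∀ t' ∈ Icc (0 : ℝ) 1, ∀ r r' : ℝ, 0 ≤ r →
      0 ≤ r' → (r : ℂ) * γ φ t = r' * γ ψ t' → r = r')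
    (hγ : ∀ φ ∈ O, ∀ ψ ∈ O, ∀ t ∈ Icc (0 : ℝ) 1, ∀ t' ∈ Icc (0 : ℝ) 1, γ φ t = γ ψ t' →
      t = t' ∧ (φ = ψ ∨ (t = 0 ∧ ψ = G.s k φ) ∨ (t = 1 ∧ ψ = G.s j φ)))
    {φ ψ : Φ} (hφ : φ ∈ O) (hψ : ψ ∈ O) {x y : stdSimplex ℝ (Fin 3)}
    (hxy : cone (γ φ) (x j) (x k) = cone (γ ψ) (y j) (y k)) :
    x = y ∧ G.Joined ({l | x l = 0} ∩ {j, k}) φ ψ := by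
  have hxj : 0 ≤ x j := x.2.1 j
  have hxk : 0 ≤ x k := x.2.1 k
  have hyj : 0 ≤ y j := y.2.1 j
  have hyk : 0 ≤ y k := y.2.1 k
  have ht := div_add_mem_Icc hxj hxk
  have ht' := div_add_mem_Icc hyj hyk
  have hr := hrad φ hφ ψ hψ _ ht _ ht' _ _ (add_nonneg hxj hxk) (add_nonneg hyj hyk) hxy
  by_cases h0 : x j + x k = 0
  · have h0' : y j + y k = 0 := hr ▸ h0
    have e1 : x j = 0 := by linarith
    have e2 : x k = 0 := by linarith
    have e3 : y j = 0 := by linarith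
    have e4 : y k = 0 := by linarith
    refine ⟨h.ext (e1.trans e3.symm) (e2.trans e4.symm), (hO φ hφ ψ hψ).mono ?_⟩
    rintro l (rfl | rfl)
    · exact ⟨e1, Or.inl rfl⟩
    · exact ⟨e2, Or.inr rfl⟩
  · rw [cone, cone, ← hr] at hxy
    have hxy' := mul_left_cancel₀ (by exact_mod_cast h0) hxy
    obtain ⟨htt, hcase⟩ := hγ φ hφ ψ hψ _ ht _ (hr ▸ ht') hxy'
    have hk : x k = y k := by
      rw [div_left_inj' h0] at htt
      exact htt
    refine ⟨h.ext (by linarith) hk, ?_⟩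
    rcases hcase with rfl | ⟨ht0, rfl⟩ | ⟨ht1, rfl⟩
    · exact .refl _
    · refine .step (S := {l | x l = 0} ∩ {j, k}) ⟨?_, Or.inr rfl⟩ _
      rcases div_eq_zero_iff.1 ht0 with h | h
      · exact h
      · exact absurd h h0
    · refine .step (S := {l | x l = 0} ∩ {j, k}) ⟨?_, Or.inl rfl⟩ _
      rw [div_eq_one_iff_eq h0] at ht1
      change x j = 0
      linarith

theorem cone_eq_of_right_eq_zero {γ γ' : ℝ → ℂ} (hγ : γ 0 = γ' 0) {a b : ℝ} (hb : b = 0) :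
    cone γ a b = cone γ' a b := by simp [cone, hb, hγ]

theorem cone_eq_of_left_eq_zero {γ γ' : ℝ → ℂ} (hγ : γ 1 = γ' 1) {a b : ℝ} (ha : a = 0) :
    cone γ a b = cone γ' a b := by
  by_cases hb : b = 0
  · simp [cone, ha, hb]
  · simp [cone, ha, hb, hγ]

end FlagSystem

/-! ### Orbits of two involutions -/

namespace FlagSystem

variable {Φ : Type u} (G : FlagSystem Φ)

/-- Apply `s j` and `s k` in turn; the Boolean tells which of the two comes next. -/
def alternate (j k : Fin 3) : Equiv.Perm (Φ × Bool) where
  toFun p := (G.s (if p.2 then k else j) p.1, !p.2)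
  invFun p := (G.s (if p.2 then j else k) p.1, !p.2)
  left_inv := by rintro ⟨φ, _ | _⟩ <;> simp [G.invol]
  right_inv := by rintro ⟨φ, _ | _⟩ <;> simp [G.invol]

/-- The orbit of a flag under two of the involutions is a cycle of even length `N`, around which
the two involutions alternate. No flag occurs twice: if `c m = c n` with `m` and `n` of different
parity, then `c (m + 1) = c (n - 1)`, and moving inwards one arrives at a fixed point of an
involution. -/
theorem exists_cycle [Finite Φ] (j k : Fin 3) (φ : Φ) : ∃ (N : ℕ) (c : ℤ → Φ), 0 < N ∧ Even N ∧
    c 0 = φ ∧ (∀ n, Even n → c (n + 1) = G.s j (c n)) ∧ (∀ n, Odd n → c (n + 1) = G.s k (c n)) ∧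
    ∀ m n, c m = c n ↔ (N : ℤ) ∣ m - n := by
  set σ := G.alternate j k with hσ
  let p : ℤ → Φ × Bool := fun n => (σ ^ n) (φ, false)
  have hp : ∀ n, p (n + 1) = σ (p n) := fun n => by
    simp only [p]
    rw [add_comm, zpow_add, zpow_one, Equiv.Perm.mul_apply]
  have hpar1 : ∀ n, (p (n + 1)).2 = !(p n).2 := fun n => by rw [hp]; rfl
  have hpar0 : ∀ n : ℤ, ¬ Odd n ↔ Odd (n + 1) := fun n => by
    rw [Int.not_odd_iff_even, Int.odd_add]
    simp
  have hpar : ∀ n, (p n).2 = decide (Odd n) := by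
    intro n
    induction n using Int.induction_on with
    | zero => simp [p]
    | succ n ih => rw [hpar1, ih, ← decide_not, decide_eq_decide, hpar0]
    | pred n ih =>
      have h := hpar1 (-n - 1)
      have h' := hpar0 (-n - 1)
      rw [sub_add_cancel, ih] at h
      rw [sub_add_cancel] at h'
      rw [← Bool.not_inj_iff, ← h, ← decide_not, decide_eq_decide, h']
  have heven : ∀ n, Even n → (p (n + 1)).1 = G.s j (p n).1 := fun n hn => by
    have h : (p n).2 = false := by rw [hpar]; simpa using hn
    rw [hp]
    simp [hσ, alternate, h]
  have hodd : ∀ n, Odd n → (p (n + 1)).1 = G.s k (p n).1 := fun n hn => by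
    have h : (p n).2 = true := by rw [hpar]; simpa using hn
    rw [hp]
    simp [hσ, alternate, h]
  have hstep : ∀ n, (p (n + 1)).1 = G.s (if Even n then j else k) (p n).1 := fun n => by
    split_ifs with h
    · exact heven n h
    · exact hodd n (Int.not_even_iff_odd.1 h)
  have hback : ∀ n, (p (n - 1)).1 = G.s (if Even n then k else j) (p n).1 := fun n => by
    have h := hstep (n - 1)
    rw [sub_add_cancel] at h
    rw [h]
    have : Even (n - 1) ↔ ¬ Even n := by simp
    by_cases hn : Even n <;> simp [this, hn, G.invol]
  have hne : ∀ d : ℕ, ∀ m : ℤ, (p m).1 ≠ (p (m + (2 * d + 1))).1 := by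
    intro d
    induction d with
    | zero =>
      intro m h
      simp only [Nat.cast_zero, mul_zero, zero_add] at h
      rw [hstep] at h
      exact G.ne _ _ h.symm
    | succ d ih =>
      intro m h
      refine ih (m + 1) ?_
      have e : m + 1 + (2 * (d : ℤ) + 1) = m + (2 * ((d + 1 : ℕ) : ℤ) + 1) - 1 := by
        push_cast; ring
      rw [e, hback, hstep, ← h]
      have : Even (m + (2 * ((d + 1 : ℕ) : ℤ) + 1)) ↔ ¬ Even m := by
        rw [Int.even_add]
        have : ¬ Even (2 * ((d + 1 : ℕ) : ℤ) + 1) := by simp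
        tauto
      by_cases hm : Even m <;> simp only [this, hm, not_true, not_false_iff, if_true, if_false]
  have hmod : ∀ m n, p m = p n ↔ ((Function.minimalPeriod σ (φ, false) : ℕ) : ℤ) ∣ m - n := by
    intro m n
    have h1 : p m = p n ↔ (σ ^ (m - n)) • (φ, false) = (φ, false) := by
      have e : (σ ^ m) (φ, false) = (σ ^ n) ((σ ^ (m - n)) (φ, false)) := by
        rw [← Equiv.Perm.mul_apply, ← zpow_add, add_sub_cancel]
      simp only [p]
      rw [e, EmbeddingLike.apply_eq_iff_eq]
      rfl
    rw [h1]
    exact MulAction.zpow_smul_eq_iff_minimalPeriod_dvd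
  refine ⟨Function.minimalPeriod σ (φ, false), fun n => (p n).1, ?_, ?_, ?_, heven, hodd, ?_⟩
  · exact Function.minimalPeriod_pos_of_mem_periodicPts
      (Function.Injective.mem_periodicPts σ.injective _)
  · have h := (hmod (Function.minimalPeriod σ (φ, false) : ℕ) 0).2 (by simp)
    have h' := congrArg Prod.snd h
    rw [hpar, hpar] at h'
    simpa using h'
  · simp [p]
  · intro m n
    rw [← hmod]
    refine ⟨fun h => Prod.ext h ?_, congrArg Prod.fst⟩
    rw [hpar, hpar]
    have key : ∀ m n : ℤ, m ≤ n → (p m).1 = (p n).1 → (Odd m ↔ Odd n) := by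
      intro m n hmn h
      by_contra hodd'
      have hd : Odd (n - m) := by
        rw [Int.odd_sub, ← Int.not_odd_iff_even]
        tauto
      obtain ⟨d, hd⟩ := hd
      have hd0 : 0 ≤ d := by omega
      lift d to ℕ using hd0
      refine hne d m ?_
      rw [← hd, add_sub_cancel]
      exact h
    rcases le_total m n with hmn | hmn
    · simp [key m n hmn h]
    · simp [key n m hmn h.symm]

end FlagSystem

/-! ### Open stars are disks -/

/-- Two maps `q` and `z` on the same space with the same kernel on a saturated open set `W` have
homeomorphic images of `W`, if `q` is a quotient map and `z` is proper over its image. -/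
theorem nonempty_homeomorph_image {A Y Z : Type*} [TopologicalSpace A] [TopologicalSpace Y]
    [TopologicalSpace Z] [T2Space Z] {q : A → Y} (hq : IsQuotientMap q) {z : A → Z}
    (hz : Continuous z) {W D : Set A} {B : Set Z} (hW : IsOpen W) (hsat : q ⁻¹' (q '' W) = W)
    (hD : IsCompact D) (hWD : ∀ a, a ∈ W ↔ a ∈ D ∧ z a ∈ B) (hB : B ⊆ z '' W)
    (hker : ∀ a ∈ W, ∀ b ∈ W, q a = q b ↔ z a = z b) :
    IsOpen (q '' W) ∧ Nonempty (q '' W ≃ₜ B) := by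
  have hopen : IsOpen (q '' W) := hq.isOpen_preimage.1 (hsat.symm ▸ hW)
  refine ⟨hopen, ?_⟩
  choose a haW haq using fun y : q '' W => y.2
  let f : q '' W → B := fun y => ⟨z (a y), ((hWD _).1 (haW y)).2⟩
  have hf : ∀ w (hw : w ∈ W), (f ⟨q w, w, hw, rfl⟩ : Z) = z w := fun w hw =>
    (hker _ (haW _) _ hw).1 (haq _)
  have hinj : Function.Injective f := by
    rintro ⟨_, w, hw, rfl⟩ ⟨_, w', hw', rfl⟩ h
    have h := congrArg Subtype.val h
    rw [hf w hw, hf w' hw'] at h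
    exact Subtype.ext ((hker w hw w' hw').2 h)
  have hsurj : Function.Surjective f := by
    rintro ⟨b, hb⟩
    obtain ⟨w, hw, rfl⟩ := hB hb
    exact ⟨⟨q w, w, hw, rfl⟩, Subtype.ext (hf w hw)⟩
  have hcont : Continuous f := by
    rw [(hq.restrictPreimage_isOpen hopen).continuous_iff, continuous_induced_rng]
    have : Subtype.val ∘ f ∘ (q '' W).restrictPreimage q = fun w => z w.1 := by
      funext w
      exact hf w.1 (hsat.subset w.2)
    rw [this]
    exact hz.comp continuous_subtype_val
  have hclosed : IsClosedMap f := by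
    intro C hC
    obtain ⟨C', hC', rfl⟩ := isClosed_induced_iff.1 hC
    refine isClosed_induced_iff.2 ⟨z '' (D ∩ q ⁻¹' C'), ?_, ?_⟩
    · exact ((hD.inter_right (hC'.preimage hq.continuous)).image hz).isClosed
    · ext b
      constructor
      · rintro ⟨w, ⟨hwD, hwC⟩, hwb⟩
        have hw : w ∈ W := (hWD w).2 ⟨hwD, hwb ▸ b.2⟩
        exact ⟨⟨q w, w, hw, rfl⟩, hwC, Subtype.ext ((hf w hw).trans hwb)⟩
      · rintro ⟨⟨_, w, hw, rfl⟩, hwC, rfl⟩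
        exact ⟨w, ⟨((hWD w).1 hw).1, hwC⟩, (hf w hw).symm⟩
  exact ⟨(Equiv.ofBijective f ⟨hinj, hsurj⟩).toHomeomorphOfContinuousClosed hcont hclosed⟩

namespace FlagSystem

/-- The `n`-th of `N` equal arcs on the unit circle, traversed forwards if `n` is even and
backwards if `n` is odd. -/
noncomputable def arc (N : ℕ) (n : ℤ) (t : ℝ) : ℂ :=
  Complex.exp (((2 * Real.pi * (n + if Even n then t else 1 - t) / N : ℝ) : ℂ) * Complex.I)

theorem norm_arc (N : ℕ) (n : ℤ) (t : ℝ) : ‖arc N n t‖ = 1 := Complex.norm_exp_ofReal_mul_I _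

theorem continuous_arc (N : ℕ) (n : ℤ) : Continuous (arc N n) := by
  unfold arc
  split_ifs <;> fun_prop

theorem norm_cone_arc (N : ℕ) (n : ℤ) {a b : ℝ} (ha : 0 ≤ a) (hb : 0 ≤ b) :
    ‖cone (arc N n) a b‖ = a + b := by
  rw [cone, norm_mul, norm_arc, mul_one, Complex.norm_real, Real.norm_of_nonneg (add_nonneg ha hb)]

theorem exp_two_pi_eq_iff {N : ℕ} (hN : 0 < N) (u v : ℝ) :
    Complex.exp (((2 * Real.pi * u / N : ℝ) : ℂ) * Complex.I) =
      Complex.exp (((2 * Real.pi * v / N : ℝ) : ℂ) * Complex.I) ↔ ∃ m : ℤ, u = v + m * N := by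
  have hN' : (N : ℂ) ≠ 0 := by exact_mod_cast hN.ne'
  have hpi : (Real.pi : ℂ) ≠ 0 := by exact_mod_cast Real.pi_ne_zero
  rw [Complex.exp_eq_exp_iff_exists_int]
  refine exists_congr fun m => ?_
  rw [← Complex.ofReal_inj]
  push_cast
  constructor
  · intro h
    field_simp at h
    linear_combination h
  · intro h
    rw [h]
    field_simp

theorem arc_congr {N : ℕ} (hN : 0 < N) (hN2 : Even N) {m n : ℤ} (h : (N : ℤ) ∣ m - n) :
    arc N m = arc N n := by
  funext t
  obtain ⟨d, hd⟩ := h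
  have hpar : Even m ↔ Even n := by
    rw [← Int.even_sub, hd]
    exact ((Int.even_coe_nat N).2 hN2).mul_right d
  rw [arc, arc, exp_two_pi_eq_iff hN]
  refine ⟨d, ?_⟩
  have hd' : (m : ℝ) - n = N * d := by exact_mod_cast hd
  simp only [hpar]
  linarith

/-- If the flags of an orbit are arranged around the unit circle, then the arcs of distinct flags
meet only in endpoints, as prescribed by the involutions. -/
theorem arc_eq_arc {Φ : Type u} {G : FlagSystem Φ} {j k : Fin 3} {N : ℕ} {c : ℤ → Φ} (hN : 0 < N)
    (hN2 : Even N) (hj : ∀ n, Even n → c (n + 1) = G.s j (c n))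
    (hk : ∀ n, Odd n → c (n + 1) = G.s k (c n)) (hc : ∀ m n, c m = c n ↔ (N : ℤ) ∣ m - n)
    {m n : ℤ} {t t' : ℝ} (ht : t ∈ Icc (0 : ℝ) 1) (ht' : t' ∈ Icc (0 : ℝ) 1)
    (h : arc N m t = arc N n t') :
    t = t' ∧ (c m = c n ∨ (t = 0 ∧ c n = G.s k (c m)) ∨ (t = 1 ∧ c n = G.s j (c m))) := by
  obtain ⟨d, hd⟩ := (exp_two_pi_eq_iff hN _ _).1 h
  -- passing to another index for the second flag, one may assume that `d = 0`
  set n' : ℤ := n + d * N with hn'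
  have hdvd : (N : ℤ) ∣ n' - n := ⟨d, by rw [hn']; ring⟩
  have hpar : Even n' ↔ Even n := by
    rw [hn', Int.even_add]
    have : Even (d * (N : ℤ)) := ((Int.even_coe_nat N).2 hN2).mul_left d
    tauto
  rw [← (hc n' n).2 hdvd]
  simp only [← hpar] at hd
  have hnr : (n' : ℝ) = n + d * N := by rw [hn']; push_cast; ring
  have hd : (m : ℝ) + (if Even m then t else 1 - t) = n' + (if Even n' then t' else 1 - t') := by
    rw [hd, hnr]; ring
  clear_value n'
  obtain ⟨ht0, ht1⟩ := ht
  obtain ⟨ht0', ht1'⟩ := ht'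
  have hle : |m - n'| ≤ 1 := by
    have h2 : |(m : ℝ) - n'| ≤ 1 := by
      rw [abs_le]
      split_ifs at hd <;> constructor <;> linarith
    exact_mod_cast h2
  obtain h | h | h : m = n' ∨ n' = m + 1 ∨ m = n' + 1 := by
    rw [abs_le] at hle
    omega
  · subst h
    refine ⟨?_, Or.inl rfl⟩
    split_ifs at hd <;> linarith
  · subst h
    push_cast at hd
    by_cases hm : Even m
    · have hm' : ¬ Even (m + 1) := by simpa [Int.even_add_one] using hm
      simp only [hm, hm', if_true, if_false] at hd
      exact ⟨by linarith, Or.inr (Or.inr ⟨by linarith, hj m hm⟩)⟩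
    · have hm' : Even (m + 1) := by simpa [Int.even_add_one] using hm
      simp only [hm, hm', if_true, if_false] at hd
      exact ⟨by linarith, Or.inr (Or.inl ⟨by linarith, hk m (Int.not_even_iff_odd.1 hm)⟩)⟩
  · subst h
    push_cast at hd
    by_cases hm : Even n'
    · have hm' : ¬ Even (n' + 1) := by simpa [Int.even_add_one] using hm
      simp only [hm, hm', if_true, if_false] at hd
      exact ⟨by linarith, Or.inr (Or.inr ⟨by linarith, by rw [hj n' hm, G.invol]⟩)⟩
    · have hm' : Even (n' + 1) := by simpa [Int.even_add_one] using hm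
      simp only [hm, hm', if_true, if_false] at hd
      exact ⟨by linarith,
        Or.inr (Or.inl ⟨by linarith, by rw [hk n' (Int.not_even_iff_odd.1 hm), G.invol]⟩)⟩

theorem arc_one_of_even {N : ℕ} {n : ℤ} (h : Even n) : arc N n 1 = arc N (n + 1) 1 := by
  have h' : ¬ Even (n + 1) := by simpa [Int.even_add_one] using h
  simp [arc, h, h']

theorem arc_zero_of_odd {N : ℕ} {n : ℤ} (h : Odd n) : arc N n 0 = arc N (n + 1) 0 := by
  have h0 : ¬ Even n := Int.not_even_iff_odd.2 h
  have h' : Even (n + 1) := by simpa [Int.even_add_one] using h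
  simp [arc, h0, h']

/-- The union of the arcs is the unit circle, so the cones over them fill the unit disk. -/
theorem exists_cone_arc_eq {N : ℕ} (hN : 0 < N) {z : ℂ} :
    ∃ n : ℤ, ∃ a b : ℝ, 0 ≤ a ∧ 0 ≤ b ∧ a + b = ‖z‖ ∧ cone (arc N n) a b = z := by
  have hN' : (N : ℝ) ≠ 0 := by exact_mod_cast hN.ne'
  set u : ℝ := z.arg * N / (2 * Real.pi) with hu
  have huz : 2 * Real.pi * u / N = z.arg := by
    rw [hu]
    field_simp
  set t : ℝ := if Even ⌊u⌋ then Int.fract u else 1 - Int.fract u with ht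
  have ht0 : 0 ≤ t ∧ t ≤ 1 := by
    have h1 := Int.fract_nonneg u
    have h2 := (Int.fract_lt_one u).le
    rw [ht]
    split_ifs <;> constructor <;> linarith
  have harc : arc N ⌊u⌋ t = Complex.exp (z.arg * Complex.I) := by
    have : (⌊u⌋ : ℝ) + (if Even ⌊u⌋ then t else 1 - t) = u := by
      rw [ht]
      split_ifs
      · exact Int.floor_add_fract u
      · rw [sub_sub_cancel]
        exact Int.floor_add_fract u
    rw [arc, this, huz]
  refine ⟨⌊u⌋, ‖z‖ * (1 - t), ‖z‖ * t, mul_nonneg (norm_nonneg _) (by linarith),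
    mul_nonneg (norm_nonneg _) ht0.1, by ring, ?_⟩
  have hsum : ‖z‖ * (1 - t) + ‖z‖ * t = ‖z‖ := by ring
  rw [cone, hsum]
  by_cases hz : z = 0
  · simp [hz]
  · rw [mul_div_cancel_left₀ _ (norm_ne_zero_iff.2 hz), harc]
    exact Complex.norm_mul_exp_arg_mul_I z

variable {Φ : Type u} (G : FlagSystem Φ) {i j k : Fin 3}

/-- The open star of the barycentre of an `i`-dimensional cell is an open disk: it is the open cone
over the cycle of triangles around the barycentre. -/
theorem isOpen_star_and_homeomorph [Finite Φ] [TopologicalSpace Φ] [DiscreteTopology Φ]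
    (h : IsTriple i j k) (φ : Φ) :
    let U := G.proj '' {p | G.Joined {j, k} φ p.1 ∧ 0 < p.2 i}
    IsOpen U ∧ Nonempty (U ≃ₜ Metric.ball (0 : ℂ) 1) := by
  obtain ⟨N, c, hN, hN2, hc0, hj, hk, hc⟩ := G.exists_cycle j k φ
  have hj' : ∀ n, Odd n → c (n - 1) = G.s j (c n) := fun n hn => by
    have h := hj (n - 1) (by simpa [Int.even_sub] using hn)
    rw [sub_add_cancel] at h
    rw [h, G.invol]
  have hk' : ∀ n, Even n → c (n - 1) = G.s k (c n) := fun n hn => by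
    have h := hk (n - 1) (by simpa [Int.odd_sub] using hn)
    rw [sub_add_cancel] at h
    rw [h, G.invol]
  have hjoin1 : ∀ n, G.Joined {j, k} (c n) (c (n + 1)) := fun n => by
    rcases Int.even_or_odd n with hn | hn
    · rw [hj n hn]; exact .step (by simp) _
    · rw [hk n hn]; exact .step (by simp) _
  have hjoin : ∀ n, G.Joined {j, k} φ (c n) := by
    intro n
    induction n using Int.induction_on with
    | zero => rw [hc0]; exact .refl _
    | succ n ih => exact ih.trans (hjoin1 _)
    | pred n ih =>
      have h := hjoin1 (-n - 1)
      rw [sub_add_cancel] at h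
      exact ih.trans h.symm
  have hex : ∀ ψ, G.Joined {j, k} φ ψ → ∃ n, c n = ψ := by
    intro ψ hψ
    induction hψ with
    | refl => exact ⟨0, hc0⟩
    | tail _ h ih =>
      obtain ⟨n, rfl⟩ := ih
      obtain ⟨l, rfl | rfl, rfl⟩ := h <;> rcases Int.even_or_odd n with hn | hn
      · exact ⟨_, hj n hn⟩
      · exact ⟨_, hj' n hn⟩
      · exact ⟨_, hk' n hn⟩
      · exact ⟨_, hk n hn⟩
  choose! idx hidx using hex
  set O : Set Φ := {ψ | G.Joined {j, k} φ ψ} with hO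
  let γ : Φ → ℝ → ℂ := fun ψ => arc N (idx ψ)
  have hγc : ∀ n, γ (c n) = arc N n := fun n =>
    arc_congr hN hN2 ((hc _ _).1 (hidx _ (hjoin n)))
  let z : Φ × stdSimplex ℝ (Fin 3) → ℂ := fun p => cone (γ p.1) (p.2 j) (p.2 k)
  have hz : Continuous z := by
    rw [continuous_prod_of_discrete_left]
    intro ψ
    have h := continuous_cone_coord (continuous_arc N (idx ψ)).continuousOn j k
    exact h
  have hznorm : ∀ p, ‖z p‖ = 1 - p.2 i := fun p => by
    have := h.sum_eq p.2
    have h : ‖z p‖ = p.2 j + p.2 k := norm_cone_arc N (idx p.1) (p.2.2.1 j) (p.2.2.1 k)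
    linarith
  have hker1 : ∀ p q : Φ × stdSimplex ℝ (Fin 3), p.1 ∈ O → q.1 ∈ O → z p = z q →
      p.2 = q.2 ∧ G.Joined ({l | p.2 l = 0} ∩ {j, k}) p.1 q.1 := by
    intro p q hp hq hpq
    refine eq_and_joined_of_cone_eq h (O := O) (γ := γ) (fun ψ hψ χ hχ => hψ.symm.trans hχ)
      ?_ ?_ hp hq hpq
    · intro ψ _ χ _ t _ t' _ r r' hr hr' e
      have e := congrArg norm e
      simpa [γ, norm_mul, norm_arc, abs_of_nonneg hr, abs_of_nonneg hr'] using e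
    · intro ψ hψ χ hχ t ht t' ht' e
      have e := arc_eq_arc hN hN2 hj hk hc (m := idx ψ) (n := idx χ) ht ht' e
      rwa [hidx ψ hψ, hidx χ hχ] at e
  have hstepj : ∀ ψ ∈ O, γ ψ 1 = γ (G.s j ψ) 1 := by
    intro ψ hψ
    rw [← hidx ψ hψ]
    generalize idx ψ = n
    rcases Int.even_or_odd n with hn | hn
    · rw [← hj n hn, hγc, hγc, arc_one_of_even hn]
    · have hn' : Even (n - 1) := by simpa [Int.even_sub] using hn
      rw [← hj' n hn, hγc, hγc, arc_one_of_even hn', sub_add_cancel]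
  have hstepk : ∀ ψ ∈ O, γ ψ 0 = γ (G.s k ψ) 0 := by
    intro ψ hψ
    rw [← hidx ψ hψ]
    generalize idx ψ = n
    rcases Int.even_or_odd n with hn | hn
    · have hn' : Odd (n - 1) := by simpa [Int.odd_sub] using hn
      rw [← hk' n hn, hγc, hγc, arc_zero_of_odd hn', sub_add_cancel]
    · rw [← hk n hn, hγc, hγc, arc_zero_of_odd hn]
  have hglue : ∀ (x : stdSimplex ℝ (Fin 3)) (ψ χ : Φ), 0 < x i → ψ ∈ O →
      G.Joined {l | x l = 0} ψ χ → χ ∈ O ∧ z (ψ, x) = z (χ, x) := by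
    intro x ψ χ hx hψ hχ
    induction hχ with
    | refl => exact ⟨hψ, rfl⟩
    | @tail χ _ _ hl ih =>
      obtain ⟨l, hl, rfl⟩ := hl
      obtain ⟨hχ, e⟩ := ih
      have hl : x l = 0 := hl
      rw [e]
      rcases h.cases l with rfl | rfl | rfl
      · exact absurd hl hx.ne'
      · exact ⟨hχ.trans (.step (by simp) _), cone_eq_of_left_eq_zero (hstepj χ hχ) hl⟩
      · exact ⟨hχ.trans (.step (by simp) _), cone_eq_of_right_eq_zero (hstepk χ hχ) hl⟩
  have hxcont : Continuous fun p : Φ × stdSimplex ℝ (Fin 3) => p.2 i :=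
    (continuous_coord i).comp continuous_snd
  have hOpre : ∀ S : Set Φ, IsClopen ((Prod.fst : Φ × stdSimplex ℝ (Fin 3) → Φ) ⁻¹' S) := fun S =>
    (isClopen_discrete S).preimage continuous_fst
  refine nonempty_homeomorph_image (D := Prod.fst ⁻¹' O) G.isQuotientMap_proj hz ?_ ?_ ?_ ?_ ?_ ?_
  · exact (hOpre O).isOpen.inter (isOpen_lt continuous_const hxcont)
  · refine Subset.antisymm ?_ (subset_preimage_image _ _)
    rintro ⟨ψ, x⟩ ⟨⟨χ, y⟩, ⟨h1, h2⟩, h3⟩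
    obtain ⟨rfl, h3⟩ := G.proj_eq_iff.1 h3
    exact ⟨(hglue y χ ψ h2 h1 h3).1, h2⟩
  · exact (hOpre O).isClosed.isCompact
  · intro p
    rw [mem_ball_zero_iff, hznorm]
    simp only [mem_ofPred_eq, mem_preimage, hO]
    exact and_congr_right fun _ => ⟨fun h => by linarith, fun h => by linarith⟩
  · intro w hw
    rw [mem_ball_zero_iff] at hw
    obtain ⟨n, a, b, ha, hb, hab, hw'⟩ := exists_cone_arc_eq hN (z := w)
    obtain ⟨x, hxi, hxj, hxk⟩ := h.exists_point ha hb (by linarith)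
    refine ⟨(c n, x), ⟨hjoin n, ?_⟩, ?_⟩
    · change 0 < x i
      linarith
    · change cone (γ (c n)) (x j) (x k) = w
      rw [hγc, hxj, hxk, hw']
  · rintro ⟨ψ, x⟩ ⟨hψ, hx⟩ ⟨χ, y⟩ ⟨hχ, hy⟩
    rw [G.proj_eq_iff]
    constructor
    · rintro ⟨rfl, e⟩
      exact (hglue x ψ χ hx hψ e).2
    · intro e
      obtain ⟨e1, e2⟩ := hker1 _ _ hψ hχ e
      exact ⟨e1, e2.mono inter_subset_left⟩

/-- The realization of a finite flag system is a surface. -/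
theorem exists_disk_nhd [Finite Φ] [TopologicalSpace Φ] [DiscreteTopology Φ]
    (y : G.Realization) : ∃ U : Set G.Realization, IsOpen U ∧ y ∈ U ∧
      Nonempty (U ≃ₜ Metric.ball (0 : ℂ) 1) := by
  obtain ⟨⟨φ, x⟩, rfl⟩ := G.proj_surjective y
  obtain ⟨i, j, k, h, hx⟩ : ∃ i j k, IsTriple i j k ∧ 0 < x i := by
    have hsum := IsTriple.sum_eq (i := 0) (j := 1) (k := 2) ⟨by decide, by decide, by decide⟩ x
    by_contra! hcon
    have h0 := hcon 0 1 2 ⟨by decide, by decide, by decide⟩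
    have h1 := hcon 1 0 2 ⟨by decide, by decide, by decide⟩
    have h2 := hcon 2 0 1 ⟨by decide, by decide, by decide⟩
    linarith
  obtain ⟨hU, hh⟩ := G.isOpen_star_and_homeomorph h φ
  exact ⟨_, hU, ⟨(φ, x), ⟨.refl _, hx⟩, rfl⟩, hh⟩

end FlagSystem

/-! ### Regular polygons -/

/-- The linear form whose value on the `k`-th side of the regular `n`-gon is `1`. -/
noncomputable def sideForm (n k : ℕ) (z : ℂ) : ℝ :=
  z.re * Real.cos (2 * Real.pi * k / n) + z.im * Real.sin (2 * Real.pi * k / n)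

theorem sideForm_mul (n k : ℕ) (r : ℝ) (z : ℂ) :
    sideForm n k ((r : ℂ) * z) = r * sideForm n k z := by
  simp only [sideForm, Complex.re_ofReal_mul, Complex.im_ofReal_mul]
  ring

theorem sideForm_le {n : ℕ} {z : ℂ} (hz : z ∈ regularPolygon n) (k : Fin n) :
    sideForm n k z ≤ 1 := hz k

theorem sideForm_eq {n : ℕ} {z : ℂ} {k : Fin n} (hz : z ∈ polygonSide n k) :
    sideForm n k z = 1 := hz.2

theorem polygonSide_subset (n : ℕ) (k : Fin n) : polygonSide n k ⊆ regularPolygon n :=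
  fun _ hz => hz.1

theorem mul_mem_regularPolygon {n : ℕ} {z : ℂ} (hz : z ∈ regularPolygon n) {r : ℝ}
    (hr : r ∈ Icc (0 : ℝ) 1) : (r : ℂ) * z ∈ regularPolygon n := by
  intro k
  change sideForm n k ((r : ℂ) * z) ≤ 1
  rw [sideForm_mul]
  have h := mul_le_mul_of_nonneg_left (sideForm_le hz k) hr.1
  linarith [hr.2]

theorem eq_of_mul_side_eq {n : ℕ} {k l : Fin n} {b c : ℂ} (hb : b ∈ polygonSide n k)
    (hc : c ∈ polygonSide n l) {r s : ℝ} (hr : 0 ≤ r) (hs : 0 ≤ s)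
    (h : (r : ℂ) * b = (s : ℂ) * c) : r = s := by
  refine le_antisymm ?_ ?_
  · have h1 := congrArg (sideForm n k) h
    rw [sideForm_mul, sideForm_mul, sideForm_eq hb, mul_one] at h1
    have := mul_le_mul_of_nonneg_left (sideForm_le hc.1 k) hs
    linarith
  · have h1 := congrArg (sideForm n l) h
    rw [sideForm_mul, sideForm_mul, sideForm_eq hc, mul_one] at h1
    have := mul_le_mul_of_nonneg_left (sideForm_le hb.1 l) hr
    linarith

theorem eq_one_of_mul_side_mem {n : ℕ} {k l : Fin n} {b : ℂ} (hb : b ∈ polygonSide n k)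
    {r : ℝ} (hr : 0 ≤ r) (h : (r : ℂ) * b ∈ polygonSide n l) : r = 1 :=
  eq_of_mul_side_eq (c := (r : ℂ) * b) hb h hr zero_le_one (by simp)

theorem sum_sideForm {n : ℕ} (hn : 3 ≤ n) (z : ℂ) : ∑ k : Fin n, sideForm n k z = 0 := by
  have hn0 : n ≠ 0 := by omega
  have h := (Complex.isPrimitiveRoot_exp n hn0).geom_sum_eq_zero (by omega)
  have hterm : ∀ k : ℕ, Complex.exp (2 * Real.pi * Complex.I / n) ^ k =
      Complex.exp ((2 * Real.pi * k / n : ℝ) * Complex.I) := fun k => by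
    rw [← Complex.exp_nat_mul]
    congr 1
    push_cast
    ring
  simp only [hterm] at h
  have hc : ∑ k ∈ Finset.range n, Real.cos (2 * Real.pi * k / n) = 0 := by
    have := congrArg Complex.re h
    simpa only [Complex.re_sum, Complex.exp_ofReal_mul_I_re, Complex.zero_re] using this
  have hs : ∑ k ∈ Finset.range n, Real.sin (2 * Real.pi * k / n) = 0 := by
    have := congrArg Complex.im h
    simpa only [Complex.im_sum, Complex.exp_ofReal_mul_I_im, Complex.zero_im] using this
  rw [Fin.sum_univ_eq_sum_range (fun k => sideForm n k z)]
  simp only [sideForm, Finset.sum_add_distrib, ← Finset.mul_sum, hc, hs]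
  ring

theorem one_mem_polygonSide {n : ℕ} (hn : 3 ≤ n) :
    (1 : ℂ) ∈ polygonSide n ⟨0, by omega⟩ := by
  refine ⟨fun k => ?_, ?_⟩
  · simpa using Real.cos_le_one _
  · simp

/-- The regular polygon is the cone from its centre over its sides. -/
theorem exists_mul_side_eq {n : ℕ} (hn : 3 ≤ n) {z : ℂ} (hz : z ∈ regularPolygon n) :
    ∃ k : Fin n, ∃ b ∈ polygonSide n k, ∃ r ∈ Icc (0 : ℝ) 1, z = (r : ℂ) * b := by
  have : Nonempty (Fin n) := ⟨⟨0, by omega⟩⟩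
  by_cases hz0 : z = 0
  · exact ⟨_, 1, one_mem_polygonSide hn, 0, ⟨le_rfl, zero_le_one⟩, by simp [hz0]⟩
  obtain ⟨k, hk⟩ := Finite.exists_max fun k : Fin n => sideForm n k z
  have hpos : 0 < sideForm n k z := by
    -- the forms add up to zero, so if none is positive then they all vanish, and so does `z`
    by_contra! hneg
    have hall : ∀ l : Fin n, sideForm n l z = 0 := fun l =>
      (Finset.sum_eq_zero_iff_of_nonpos fun l _ => (hk l).trans hneg).1 (sum_sideForm hn z) l
        (Finset.mem_univ l)
    have hre : z.re = 0 := by simpa [sideForm] using hall ⟨0, by omega⟩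
    have him := hall ⟨1, by omega⟩
    have hn' : (3 : ℝ) ≤ n := by exact_mod_cast hn
    have hsin : 0 < Real.sin (2 * Real.pi * (1 : ℕ) / n) := by
      apply Real.sin_pos_of_pos_of_lt_pi
      · have := Real.pi_pos
        positivity
      · rw [div_lt_iff₀ (by linarith)]
        push_cast
        nlinarith [Real.pi_pos]
    rw [sideForm, hre, zero_mul, zero_add] at him
    rcases mul_eq_zero.1 him with h | h
    · exact hz0 (Complex.ext hre h)
    · exact hsin.ne' h
  set μ := sideForm n k z with hμ
  have hμ0 : (μ : ℂ) ≠ 0 := by exact_mod_cast hpos.ne'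
  refine ⟨k, ((μ⁻¹ : ℝ) : ℂ) * z, ⟨fun l => ?_, ?_⟩, μ, ⟨hpos.le, sideForm_le hz k⟩, ?_⟩
  · change sideForm n l (((μ⁻¹ : ℝ) : ℂ) * z) ≤ 1
    rw [sideForm_mul, inv_mul_le_one₀ hpos]
    exact hk l
  · change sideForm n k (((μ⁻¹ : ℝ) : ℂ) * z) = 1
    rw [sideForm_mul, ← hμ, inv_mul_cancel₀ hpos.ne']
  · push_cast
    rw [mul_inv_cancel_left₀ hμ0]

theorem eq_of_cos_eq_of_sin_eq {n : ℕ} {k l : Fin n}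
    (hc : Real.cos (2 * Real.pi * (k : ℕ) / n) = Real.cos (2 * Real.pi * (l : ℕ) / n))
    (hs : Real.sin (2 * Real.pi * (k : ℕ) / n) = Real.sin (2 * Real.pi * (l : ℕ) / n)) : k = l := by
  obtain ⟨m, hm⟩ := Real.Angle.angle_eq_iff_two_pi_dvd_sub.1 (Real.Angle.cos_sin_inj hc hs)
  have hn : (n : ℝ) ≠ 0 := by
    have := k.2
    exact_mod_cast (by omega : n ≠ 0)
  have hpi := Real.pi_ne_zero
  field_simp at hm
  have hm' : ((k : ℕ) : ℤ) - (l : ℕ) = n * m := by exact_mod_cast hm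
  have h0 : ((k : ℕ) : ℤ) - (l : ℕ) = 0 := by
    refine Int.eq_zero_of_abs_lt_dvd ⟨m, hm'⟩ ?_
    have := k.2
    have := l.2
    rw [abs_lt]
    omega
  exact Fin.ext (by omega)

/-- No three sides of a regular polygon have a common point: the corresponding unit normals would
lie on a line. -/
theorem eq_of_mem_three_sides {n : ℕ} {j k l : Fin n} {z : ℂ} (hj : z ∈ polygonSide n j)
    (hk : z ∈ polygonSide n k) (hl : z ∈ polygonSide n l) (hjk : j ≠ k) (hjl : j ≠ l) : k = l := by
  have key : ∀ a b : Fin n, z ∈ polygonSide n a → z ∈ polygonSide n b →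
      z.re * Real.sin (2 * Real.pi * (a : ℕ) / n) - z.im * Real.cos (2 * Real.pi * (a : ℕ) / n) =
      z.re * Real.sin (2 * Real.pi * (b : ℕ) / n) - z.im * Real.cos (2 * Real.pi * (b : ℕ) / n) →
      a = b := by
    intro a b ha hb h
    have ha' := ha.2
    have hb' := hb.2
    have hne : z.re ^ 2 + z.im ^ 2 ≠ 0 := by
      intro h0
      have h1 : z.re = 0 := by nlinarith
      have h2 : z.im = 0 := by nlinarith
      simp [h1, h2] at ha'
    apply eq_of_cos_eq_of_sin_eq
    · apply mul_left_cancel₀ hne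
      linear_combination z.re * (ha' - hb') - z.im * h
    · apply mul_left_cancel₀ hne
      linear_combination z.im * (ha' - hb') + z.re * h
  have hsq : ∀ a : Fin n, z ∈ polygonSide n a → (z.re * Real.sin (2 * Real.pi * (a : ℕ) / n) -
      z.im * Real.cos (2 * Real.pi * (a : ℕ) / n)) ^ 2 = z.re ^ 2 + z.im ^ 2 - 1 := by
    intro a ha
    have ha' := ha.2
    have := Real.sin_sq_add_cos_sq (2 * Real.pi * (a : ℕ) / n)
    generalize Real.sin (2 * Real.pi * (a : ℕ) / n) = s at *
    generalize Real.cos (2 * Real.pi * (a : ℕ) / n) = c at *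
    linear_combination (z.re ^ 2 + z.im ^ 2) * this - (z.re * c + z.im * s + 1) * ha'
  rcases sq_eq_sq_iff_eq_or_eq_neg.1 ((hsq j hj).trans (hsq k hk).symm) with h1 | h1
  · exact absurd (key j k hj hk h1) hjk
  rcases sq_eq_sq_iff_eq_or_eq_neg.1 ((hsq j hj).trans (hsq l hl).symm) with h2 | h2
  · exact absurd (key j l hj hl h2) hjl
  exact key k l hk hl (by linarith)

theorem cos_odd_mul_le {n : ℕ} (hn : 3 ≤ n) {d : ℤ} (hd : Odd d) (h : |d| ≤ 2 * n - 1) :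
    Real.cos (d * Real.pi / n) ≤ Real.cos (Real.pi / n) := by
  have hn0 : (0 : ℝ) < n := by exact_mod_cast (by omega : 0 < n)
  have hpi := Real.pi_pos
  have h1 : 1 ≤ |d| := Int.one_le_abs (by rintro rfl; simp at hd)
  have h1' : (1 : ℝ) ≤ |(d : ℝ)| := by exact_mod_cast h1
  have h2' : |(d : ℝ)| ≤ 2 * n - 1 := by exact_mod_cast h
  have habs : |(d : ℝ) * Real.pi / n| = |(d : ℝ)| * Real.pi / n := by
    rw [abs_div, abs_mul, abs_of_pos hpi, abs_of_pos hn0]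
  rw [← Real.cos_abs, habs]
  rcases le_total (|(d : ℝ)|) n with hle | hle
  · apply Real.cos_le_cos_of_nonneg_of_le_pi (by positivity)
    · rw [div_le_iff₀ hn0]
      nlinarith
    · gcongr
      nlinarith
  · rw [← Real.cos_two_pi_sub]
    apply Real.cos_le_cos_of_nonneg_of_le_pi (by positivity)
    · rw [sub_le_iff_le_add, ← sub_le_iff_le_add', le_div_iff₀ hn0]
      nlinarith
    · rw [le_sub_iff_add_le, ← le_sub_iff_add_le', div_le_iff₀ hn0,
        sub_mul, div_mul_cancel₀ _ hn0.ne']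
      nlinarith

/-- Consecutive sides of a regular polygon have a common point. -/
theorem side_inter_nonempty {n : ℕ} (hn : 3 ≤ n) {k l : Fin n}
    (hkl : (l : ℕ) = k + 1 ∨ (k : ℕ) = n - 1 ∧ (l : ℕ) = 0) :
    (polygonSide n k ∩ polygonSide n l).Nonempty := by
  have hn0 : (0 : ℝ) < n := by exact_mod_cast (by omega : 0 < n)
  have hn3 : (3 : ℝ) ≤ n := by exact_mod_cast hn
  have hpi := Real.pi_pos
  have hcos : 0 < Real.cos (Real.pi / n) := by
    apply Real.cos_pos_of_mem_Ioo
    constructor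
    · have : 0 < Real.pi / n := by positivity
      linarith
    · rw [div_lt_div_iff₀ hn0 two_pos]
      nlinarith
  set θ : ℝ := (2 * (k : ℕ) + 1) * Real.pi / n with hθ
  let z : ℂ := ⟨Real.cos θ / Real.cos (Real.pi / n), Real.sin θ / Real.cos (Real.pi / n)⟩
  have hform : ∀ j : ℕ, z.re * Real.cos (2 * Real.pi * j / n) +
      z.im * Real.sin (2 * Real.pi * j / n) =
      Real.cos (((2 * k + 1 - 2 * j : ℤ) : ℝ) * Real.pi / n) / Real.cos (Real.pi / n) := by
    intro j
    have : ((2 * k + 1 - 2 * j : ℤ) : ℝ) * Real.pi / n = θ - 2 * Real.pi * j / n := by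
      rw [hθ]
      push_cast
      ring
    rw [this, Real.cos_sub]
    simp only [z]
    ring
  have hz : z ∈ regularPolygon n := by
    intro j
    rw [hform, div_le_one hcos]
    have hk := k.2
    have hj := j.2
    refine cos_odd_mul_le hn ?_ ?_
    · rw [Int.odd_sub]
      simp
    · rw [abs_le]
      constructor <;> omega
  refine ⟨z, ⟨hz, ?_⟩, hz, ?_⟩
  · rw [hform]
    have : (2 * (k : ℕ) + 1 - 2 * (k : ℕ) : ℤ) = 1 := by ring
    rw [this, Int.cast_one, one_mul, div_self hcos.ne']
  · rw [hform, div_eq_one_iff_eq hcos.ne']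
    rcases hkl with h | ⟨h, h'⟩
    · have : (2 * (k : ℕ) + 1 - 2 * (l : ℕ) : ℤ) = -1 := by rw [h]; push_cast; ring
      rw [this]
      push_cast
      rw [neg_one_mul, neg_div, Real.cos_neg]
    · have : (2 * (k : ℕ) + 1 - 2 * (l : ℕ) : ℤ) = 2 * n - 1 := by rw [h, h']; omega
      rw [this, ← Real.cos_two_pi_sub]
      congr 1
      push_cast
      field_simp
      ring

/-- Each side of a regular polygon meets two further sides, in distinct points. -/
theorem exists_adjacent_sides {n : ℕ} (hn : 3 ≤ n) (k : Fin n) : ∃ j l : Fin n, ∃ p q : ℂ,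
    j ≠ k ∧ l ≠ k ∧ j ≠ l ∧ p ≠ q ∧ p ∈ polygonSide n k ∧ q ∈ polygonSide n k ∧
      p ∈ polygonSide n j ∧ q ∈ polygonSide n l := by
  have hk := k.2
  obtain ⟨l, hl⟩ : ∃ l : Fin n, (l : ℕ) = k + 1 ∨ (k : ℕ) = n - 1 ∧ (l : ℕ) = 0 := by
    by_cases h : (k : ℕ) = n - 1
    · exact ⟨⟨0, by omega⟩, Or.inr ⟨h, rfl⟩⟩
    · exact ⟨⟨k + 1, by omega⟩, Or.inl rfl⟩
  obtain ⟨j, hj⟩ : ∃ j : Fin n, (k : ℕ) = j + 1 ∨ (j : ℕ) = n - 1 ∧ (k : ℕ) = 0 := by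
    by_cases h : (k : ℕ) = 0
    · exact ⟨⟨n - 1, by omega⟩, Or.inr ⟨rfl, h⟩⟩
    · exact ⟨⟨k - 1, by omega⟩, Or.inl (by simp only; omega)⟩
  have hjk : j ≠ k := fun e => by subst e; omega
  have hlk : l ≠ k := fun e => by subst e; omega
  have hjl : j ≠ l := fun e => by subst e; omega
  obtain ⟨p, hpj, hpk⟩ := side_inter_nonempty hn hj
  obtain ⟨q, hqk, hql⟩ := side_inter_nonempty hn hl
  refine ⟨j, l, p, q, hjk, hlk, hjl, ?_, hpk, hqk, hpj, hql⟩
  rintro rfl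
  exact hjl (eq_of_mem_three_sides hpk hpj hql hjk.symm hlk.symm)

theorem polygonSide_injective {n : ℕ} (hn : 3 ≤ n) : Function.Injective (polygonSide n) := by
  intro k m hkm
  by_contra hne
  obtain ⟨j, l, p, q, hjk, hlk, hjl, -, hpk, hqk, hpj, hql⟩ := exists_adjacent_sides hn k
  have h1 := eq_of_mem_three_sides hpk (hkm ▸ hpk) hpj hne hjk.symm
  have h2 := eq_of_mem_three_sides hqk (hkm ▸ hqk) hql hne hlk.symm
  exact hjl (h1.symm.trans h2)

/-- The boundary of a regular polygon is connected: a nonempty set of sides that contains with a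
side also those that meet it contains all sides. -/
theorem forall_sides {n : ℕ} (hn : 3 ≤ n) {T : Fin n → Prop} {k₀ : Fin n} (h₀ : T k₀)
    (hT : ∀ k l, (polygonSide n k ∩ polygonSide n l).Nonempty → T k → T l) (k : Fin n) : T k := by
  have hnext : ∀ m : ℕ, ∀ hm : m < n, (k₀ : ℕ) ≤ m → T ⟨m, hm⟩ := by
    intro m hm hk
    induction m, hk using Nat.le_induction with
    | base => exact h₀
    | succ m hkm ih =>
      exact hT ⟨m, by omega⟩ _ (side_inter_nonempty hn (Or.inl rfl)) (ih (by omega))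
  have hk₀ := k₀.2
  have hzero : T ⟨0, by omega⟩ :=
    hT ⟨n - 1, by omega⟩ _ (side_inter_nonempty hn (Or.inr ⟨rfl, rfl⟩))
      (hnext _ (by omega) (by omega))
  obtain ⟨k, hk⟩ := k
  induction k with
  | zero => exact hzero
  | succ m ih =>
    exact hT ⟨m, by omega⟩ _ (side_inter_nonempty hn (Or.inl rfl)) (ih (by omega))

/-! ### Flags of a 2-complex -/

theorem even_ncard_of_involution {α : Type*} {S : Set α} (hS : S.Finite) (g : ∀ a ∈ S, α)
    (hg : ∀ a ha, g a ha ∈ S) (hne : ∀ a ha, g a ha ≠ a)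
    (hinv : ∀ a ha, g (g a ha) (hg a ha) = a) : Even S.ncard := by
  rw [ncard_eq_toFinset_card S hS, ← ZMod.natCast_eq_zero_iff_even]
  have h : ∑ _a ∈ hS.toFinset, (1 : ZMod 2) = 0 :=
    Finset.sum_involution (fun a ha => g a (hS.mem_toFinset.1 ha)) (fun _ _ => by decide)
      (fun a ha _ => hne a _) (fun a ha => hS.mem_toFinset.2 (hg a _)) fun a ha => hinv a _
  simpa using h

theorem exists_involution_of_even_ncard {α : Type*} {S : Set α} (hS : S.Finite)
    (h : Even S.ncard) : ∃ g : α → α, ∀ a ∈ S, g a ∈ S ∧ g a ≠ a ∧ g (g a) = a := by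
  classical
  obtain ⟨m, hm⟩ := h
  have : Finite S := hS
  have hcard : Nat.card S = Nat.card (Fin m × Bool) := by
    rw [Nat.card_coe_set_eq, hm, Nat.card_prod, Nat.card_eq_fintype_card, Nat.card_eq_fintype_card,
      Fintype.card_fin, Fintype.card_bool]
    ring
  obtain ⟨E⟩ : Nonempty (S ≃ Fin m × Bool) := ⟨(Finite.card_eq.1 hcard).some⟩
  let flip : S → S := fun a => E.symm ((E a).1, !(E a).2)
  have hflip : ∀ a, flip (flip a) = a := fun a => by simp [flip]
  have hne : ∀ a, flip a ≠ a := fun a h => by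
    have h := congrArg Prod.snd (congrArg E h)
    simp [flip] at h
  refine ⟨fun a => if ha : a ∈ S then flip ⟨a, ha⟩ else a, fun a ha => ?_⟩
  simp only [ha, dif_pos, Subtype.coe_prop, Subtype.coe_eta, hflip, true_and, and_true]
  exact fun h => hne ⟨a, ha⟩ (Subtype.ext h)

namespace TwoComplex

variable {X : Type u} [TopologicalSpace X]

/-- A parametrization of a face of a 2-complex by a regular polygon. -/
structure FaceChart (K : TwoComplex X) (f : Set X) where
  /-- The number of sides. -/
  n : ℕ
  three_le : 3 ≤ n
  /-- The parametrization (only its values on the polygon matter). -/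
  h : ℂ → X
  isEmbedding : IsEmbedding ((regularPolygon n).domRestrict h)
  image_eq : h '' regularPolygon n = f
  side_mem : ∀ k : Fin n, h '' polygonSide n k ∈ K.E
  mem_side : ∀ z ∈ regularPolygon n, h z ∈ K.V ∪ ⋃₀ K.E → ∃ k : Fin n, z ∈ polygonSide n k

/-- A parametrization of an edge of a 2-complex by the unit interval. -/
structure EdgeChart (K : TwoComplex X) (e : Set X) where
  /-- The parametrization (only its values on the unit interval matter). -/
  h : ℝ → X
  isEmbedding : IsEmbedding ((Icc (0 : ℝ) 1).domRestrict h)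
  image_eq : h '' Icc (0 : ℝ) 1 = e
  mem_V : ∀ t ∈ Icc (0 : ℝ) 1, h t ∈ K.V ↔ t = 0 ∨ t = 1

variable {K : TwoComplex X} {f e : Set X}

theorem nonempty_faceChart (hf : f ∈ K.F) : Nonempty (K.FaceChart f) := by
  obtain ⟨n, hn, h, h1, h2, h3, h4⟩ := K.face_cell f hf
  exact ⟨⟨n, hn, h, h1, h2, h3, h4⟩⟩

theorem nonempty_edgeChart (he : e ∈ K.E) : Nonempty (K.EdgeChart e) := by
  obtain ⟨h, h1, h2, h3⟩ := K.edge_cell e he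
  exact ⟨⟨h, h1, h2, h3⟩⟩

/-- A chosen parametrization of a face. -/
noncomputable def faceChart (hf : f ∈ K.F) : K.FaceChart f := (nonempty_faceChart hf).some

/-- A chosen parametrization of an edge. -/
noncomputable def edgeChart (he : e ∈ K.E) : K.EdgeChart e := (nonempty_edgeChart he).some

namespace EdgeChart

variable (c : K.EdgeChart e)

theorem injOn : InjOn c.h (Icc 0 1) := injOn_iff_injective.2 c.isEmbedding.injective

theorem mem {t : ℝ} (ht : t ∈ Icc (0 : ℝ) 1) : c.h t ∈ e :=
  c.image_eq.subset (mem_image_of_mem _ ht)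

theorem zero_ne_one : c.h 0 ≠ c.h 1 := fun h =>
  _root_.zero_ne_one (c.injOn ⟨le_rfl, zero_le_one⟩ ⟨zero_le_one, le_rfl⟩ h)

theorem eq_or_eq {v : X} (hv : v ∈ K.V) (hve : v ∈ e) : v = c.h 0 ∨ v = c.h 1 := by
  rw [← c.image_eq] at hve
  obtain ⟨t, ht, rfl⟩ := hve
  rcases (c.mem_V t ht).1 hv with rfl | rfl <;> simp

end EdgeChart

/-- Each end of an edge has exactly one opposite end. -/
theorem exists_other_vertex (he : e ∈ K.E) {v : X} (hv : v ∈ K.V) (hve : v ∈ e) :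
    ∃ w ∈ K.V, w ∈ e ∧ w ≠ v ∧ ∀ u ∈ K.V, u ∈ e → u = v ∨ u = w := by
  have c := edgeChart he
  have m0 : (0 : ℝ) ∈ Icc (0 : ℝ) 1 := ⟨le_rfl, zero_le_one⟩
  have m1 : (1 : ℝ) ∈ Icc (0 : ℝ) 1 := ⟨zero_le_one, le_rfl⟩
  rcases c.eq_or_eq hv hve with rfl | rfl
  · exact ⟨c.h 1, (c.mem_V 1 m1).2 (Or.inr rfl), c.mem m1, c.zero_ne_one.symm,
      fun u hu hue => c.eq_or_eq hu hue⟩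
  · exact ⟨c.h 0, (c.mem_V 0 m0).2 (Or.inl rfl), c.mem m0, c.zero_ne_one,
      fun u hu hue => (c.eq_or_eq hu hue).symm⟩

theorem exists_vertex (he : e ∈ K.E) : ∃ v ∈ K.V, v ∈ e := by
  have c := edgeChart he
  have m0 : (0 : ℝ) ∈ Icc (0 : ℝ) 1 := ⟨le_rfl, zero_le_one⟩
  exact ⟨c.h 0, (c.mem_V 0 m0).2 (Or.inl rfl), c.mem m0⟩

namespace FaceChart

variable (c : K.FaceChart f)

theorem injOn : InjOn c.h (regularPolygon c.n) := injOn_iff_injective.2 c.isEmbedding.injective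

theorem mem {z : ℂ} (hz : z ∈ regularPolygon c.n) : c.h z ∈ f :=
  c.image_eq.subset (mem_image_of_mem _ hz)

theorem side_subset (k : Fin c.n) : c.h '' polygonSide c.n k ⊆ f :=
  (image_mono (polygonSide_subset _ _)).trans c.image_eq.subset

theorem mem_side_iff {z : ℂ} (hz : z ∈ regularPolygon c.n) (k : Fin c.n) :
    c.h z ∈ c.h '' polygonSide c.n k ↔ z ∈ polygonSide c.n k :=
  c.injOn.mem_image_iff (polygonSide_subset _ _) hz

theorem side_injective : Function.Injective fun k => c.h '' polygonSide c.n k := fun _ _ hkl =>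
  polygonSide_injective c.three_le
    ((c.injOn.image_eq_image_iff (polygonSide_subset _ _) (polygonSide_subset _ _)).1 hkl)

/-- An edge that lies in a face is one of its sides: the midpoint of the edge lies on some side,
and it is not a vertex. -/
theorem exists_side_eq (he : e ∈ K.E) (hef : e ⊆ f) : ∃ k, c.h '' polygonSide c.n k = e := by
  have d := edgeChart he
  have hm : (1 / 2 : ℝ) ∈ Icc (0 : ℝ) 1 := by constructor <;> norm_num
  have hnV : d.h (1 / 2) ∉ K.V := fun h => by
    rcases (d.mem_V _ hm).1 h with h | h <;> norm_num at h
  have hmem := d.mem hm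
  have hmf := hef hmem
  rw [← c.image_eq] at hmf
  obtain ⟨z, hz, hze⟩ := hmf
  obtain ⟨k, hk⟩ := c.mem_side z hz (Or.inr ⟨e, he, hze ▸ hmem⟩)
  refine ⟨k, ?_⟩
  by_contra hne
  exact hnV (K.edge_inter _ (c.side_mem k) e he hne ⟨hze ▸ mem_image_of_mem _ hk, hmem⟩)

theorem mem_V_of_two_sides {z : ℂ} {k l : Fin c.n} (hkl : k ≠ l) (hk : z ∈ polygonSide c.n k)
    (hl : z ∈ polygonSide c.n l) : c.h z ∈ K.V :=
  K.edge_inter _ (c.side_mem k) _ (c.side_mem l) (fun h => hkl (c.side_injective h))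
    ⟨mem_image_of_mem _ hk, mem_image_of_mem _ hl⟩

/-- Each end of a side of a face lies on exactly one other side. -/
theorem exists_other_edge (c : K.FaceChart f) (he : e ∈ K.E) (hef : e ⊆ f) {v : X}
    (hv : v ∈ K.V) (hve : v ∈ e) :
    ∃ e' ∈ K.E, e' ⊆ f ∧ v ∈ e' ∧ e' ≠ e ∧
      ∀ e'' ∈ K.E, e'' ⊆ f → v ∈ e'' → e'' = e ∨ e'' = e' := by
  obtain ⟨k, rfl⟩ := c.exists_side_eq he hef
  obtain ⟨j, l, p, q, hjk, hlk, -, hpq, hpk, hqk, hpj, hql⟩ := exists_adjacent_sides c.three_le k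
  have key : ∀ m p, m ≠ k → p ∈ polygonSide c.n k → p ∈ polygonSide c.n m → v = c.h p →
      ∃ e' ∈ K.E, e' ⊆ f ∧ v ∈ e' ∧ e' ≠ c.h '' polygonSide c.n k ∧
        ∀ e'' ∈ K.E, e'' ⊆ f → v ∈ e'' → e'' = c.h '' polygonSide c.n k ∨ e'' = e' := by
    rintro m p hmk hpk hpm rfl
    refine ⟨c.h '' polygonSide c.n m, c.side_mem m, c.side_subset m, mem_image_of_mem _ hpm,
      fun h => hmk (c.side_injective h), fun e'' he'' hef'' hve'' => ?_⟩
    obtain ⟨i, rfl⟩ := c.exists_side_eq he'' hef''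
    have hpi := (c.mem_side_iff hpk.1 i).1 hve''
    by_cases hik : i = k
    · exact Or.inl (by rw [hik])
    · exact Or.inr (by rw [eq_of_mem_three_sides hpk hpi hpm (Ne.symm hik) (Ne.symm hmk)])
  obtain ⟨w, hw, hwe, hwv, hall⟩ := exists_other_vertex he hv hve
  have hp := hall _ (c.mem_V_of_two_sides hjk hpj hpk) (mem_image_of_mem _ hpk)
  have hq := hall _ (c.mem_V_of_two_sides hlk hql hqk) (mem_image_of_mem _ hqk)
  have hpq' : c.h p ≠ c.h q := fun h => hpq (c.injOn hpk.1 hqk.1 h)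
  rcases hp with hp | hp
  · exact key j p hjk hpk hpj hp.symm
  · rcases hq with hq | hq
    · exact key l q hlk hqk hql hq.symm
    · exact absurd (hp.trans hq.symm) hpq'

end FaceChart

/-- A flag of a 2-complex: a vertex of an edge of a face. -/
@[ext]
structure Flag (K : TwoComplex X) where
  /-- The face. -/
  f : Set X
  /-- The edge. -/
  e : Set X
  /-- The vertex. -/
  v : X
  hf : f ∈ K.F
  he : e ∈ K.E
  hv : v ∈ K.V
  hef : e ⊆ f
  hve : v ∈ e

instance : Finite K.Flag := by
  have := K.finite_F.to_subtype
  have := K.finite_E.to_subtype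
  have := K.finite_V.to_subtype
  refine Finite.of_injective
    (fun φ : K.Flag => ((⟨φ.f, φ.hf⟩, ⟨φ.e, φ.he⟩, ⟨φ.v, φ.hv⟩) : K.F × K.E × K.V)) ?_
  intro φ ψ h
  simp only [Prod.mk.injEq, Subtype.mk.injEq] at h
  exact Flag.ext h.1 h.2.1 h.2.2

/-- The finite set of flags carries the discrete topology. -/
instance : TopologicalSpace K.Flag := ⊥

instance : DiscreteTopology K.Flag := ⟨rfl⟩

theorem exists_flag_of_edge (hf : f ∈ K.F) (he : e ∈ K.E) (hef : e ⊆ f) :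
    ∃ φ : K.Flag, φ.f = f ∧ φ.e = e := by
  obtain ⟨v, hv, hve⟩ := exists_vertex he
  exact ⟨⟨f, e, v, hf, he, hv, hef, hve⟩, rfl, rfl⟩

theorem exists_flag_of_face (hf : f ∈ K.F) : ∃ φ : K.Flag, φ.f = f := by
  have c := faceChart hf
  have hn := c.three_le
  obtain ⟨φ, h, -⟩ :=
    exists_flag_of_edge hf (c.side_mem ⟨0, by omega⟩) (c.side_subset ⟨0, by omega⟩)
  exact ⟨φ, h⟩

/-- The `i`-th involution of the flag system `G` on the flags of `K` changes only the
`i`-dimensional member of a flag, and the change of face depends only on the edge and the face: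
thus `G` amounts to a pairing of the faces at each edge. -/
structure IsCompatible (K : TwoComplex X) (G : FlagSystem K.Flag) : Prop where
  f_zero : ∀ φ, (G.s 0 φ).f = φ.f
  e_zero : ∀ φ, (G.s 0 φ).e = φ.e
  f_one : ∀ φ, (G.s 1 φ).f = φ.f
  v_one : ∀ φ, (G.s 1 φ).v = φ.v
  e_two : ∀ φ, (G.s 2 φ).e = φ.e
  v_two : ∀ φ, (G.s 2 φ).v = φ.v
  f_two : ∀ φ ψ : K.Flag, φ.f = ψ.f → φ.e = ψ.e → (G.s 2 φ).f = (G.s 2 ψ).f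

theorem exists_isCompatible (hK : K.IsEven) : ∃ G : FlagSystem K.Flag, K.IsCompatible G := by
  have h0 : ∀ φ : K.Flag, ∃ ψ : K.Flag, ψ.f = φ.f ∧ ψ.e = φ.e ∧ ψ ≠ φ ∧
      ∀ χ : K.Flag, χ.f = φ.f → χ.e = φ.e → χ = φ ∨ χ = ψ := by
    intro φ
    obtain ⟨w, hw, hwe, hwv, hall⟩ := exists_other_vertex φ.he φ.hv φ.hve
    refine ⟨⟨φ.f, φ.e, w, φ.hf, φ.he, hw, φ.hef, hwe⟩, rfl, rfl, fun h => hwv congr(($h).v), ?_⟩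
    intro χ hχf hχe
    rcases hall χ.v χ.hv (hχe ▸ χ.hve) with h | h
    · exact Or.inl (Flag.ext hχf hχe h)
    · exact Or.inr (Flag.ext hχf hχe h)
  have h1 : ∀ φ : K.Flag, ∃ ψ : K.Flag, ψ.f = φ.f ∧ ψ.v = φ.v ∧ ψ ≠ φ ∧
      ∀ χ : K.Flag, χ.f = φ.f → χ.v = φ.v → χ = φ ∨ χ = ψ := by
    intro φ
    obtain ⟨e', he', hef', hve', hne, hall⟩ :=
      (faceChart φ.hf).exists_other_edge φ.he φ.hef φ.hv φ.hve
    refine ⟨⟨φ.f, e', φ.v, φ.hf, he', φ.hv, hef', hve'⟩, rfl, rfl, fun h => hne congr(($h).e), ?_⟩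
    intro χ hχf hχv
    rcases hall χ.e χ.he (hχf ▸ χ.hef) (hχv ▸ χ.hve) with h | h
    · exact Or.inl (Flag.ext hχf h hχv)
    · exact Or.inr (Flag.ext hχf h hχv)
  have h2 : ∀ e : Set X, ∃ g : Set X → Set X, e ∈ K.E → ∀ f ∈ {f ∈ K.F | e ⊆ f},
      g f ∈ {f ∈ K.F | e ⊆ f} ∧ g f ≠ f ∧ g (g f) = f := by
    intro e
    by_cases he : e ∈ K.E
    · obtain ⟨g, hg⟩ := exists_involution_of_even_ncard
        (K.finite_F.subset (fun f hf => hf.1 : {f ∈ K.F | e ⊆ f} ⊆ K.F)) (hK e he).2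
      exact ⟨g, fun _ => hg⟩
    · exact ⟨id, fun h => absurd h he⟩
  choose s₀ hs₀f hs₀e hs₀ne hs₀ using h0
  choose s₁ hs₁f hs₁v hs₁ne hs₁ using h1
  choose pair hpair using h2
  have hp : ∀ φ : K.Flag, pair φ.e φ.f ∈ {f ∈ K.F | φ.e ⊆ f} ∧ pair φ.e φ.f ≠ φ.f ∧
      pair φ.e (pair φ.e φ.f) = φ.f := fun φ => hpair φ.e φ.he φ.f ⟨φ.hf, φ.hef⟩
  let s₂ : K.Flag → K.Flag := fun φ =>
    ⟨pair φ.e φ.f, φ.e, φ.v, (hp φ).1.1, φ.he, φ.hv, (hp φ).1.2, φ.hve⟩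
  refine ⟨⟨![s₀, s₁, s₂], ?_, ?_⟩, ⟨hs₀f, hs₀e, hs₁f, hs₁v, fun _ => rfl, fun _ => rfl, ?_⟩⟩
  · intro i φ
    fin_cases i
    · have h := hs₀ (s₀ φ) φ (hs₀f φ).symm (hs₀e φ).symm
      exact (h.resolve_left (hs₀ne φ).symm).symm
    · have h := hs₁ (s₁ φ) φ (hs₁f φ).symm (hs₁v φ).symm
      exact (h.resolve_left (hs₁ne φ).symm).symm
    · exact Flag.ext (hp φ).2.2 rfl rfl
  · intro i φ
    fin_cases i
    · exact hs₀ne φ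
    · exact hs₁ne φ
    · exact fun h => (hp φ).2.1 congr(($h).f)
  · intro φ ψ hf he
    change pair φ.e φ.f = pair ψ.e ψ.f
    rw [hf, he]

namespace IsCompatible

variable {G : FlagSystem K.Flag}

theorem eq_or_eq_zero (hG : K.IsCompatible G) {φ ψ : K.Flag} (hf : ψ.f = φ.f)
    (he : ψ.e = φ.e) :
    ψ = φ ∨ ψ = G.s 0 φ := by
  obtain ⟨w, -, -, -, hall⟩ := exists_other_vertex φ.he φ.hv φ.hve
  have h1 := hall ψ.v ψ.hv (he ▸ ψ.hve)
  have h2 := hall (G.s 0 φ).v (G.s 0 φ).hv (hG.e_zero φ ▸ (G.s 0 φ).hve)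
  have h3 : (G.s 0 φ).v ≠ φ.v := fun h => G.ne 0 φ (Flag.ext (hG.f_zero φ) (hG.e_zero φ) h)
  rcases h1 with h1 | h1
  · exact Or.inl (Flag.ext hf he h1)
  · exact Or.inr (Flag.ext (hf.trans (hG.f_zero φ).symm) (he.trans (hG.e_zero φ).symm)
      (h1.trans (h2.resolve_left h3).symm))

theorem eq_or_eq_one (hG : K.IsCompatible G) {φ ψ : K.Flag} (hf : ψ.f = φ.f) (hv : ψ.v = φ.v) :
    ψ = φ ∨ ψ = G.s 1 φ := by
  obtain ⟨e', -, -, -, -, hall⟩ :=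
    (faceChart φ.hf).exists_other_edge φ.he φ.hef φ.hv φ.hve
  have h1 := hall ψ.e ψ.he (hf ▸ ψ.hef) (hv ▸ ψ.hve)
  have h2 := hall (G.s 1 φ).e (G.s 1 φ).he (hG.f_one φ ▸ (G.s 1 φ).hef)
    (hG.v_one φ ▸ (G.s 1 φ).hve)
  have h3 : (G.s 1 φ).e ≠ φ.e := fun h => G.ne 1 φ (Flag.ext (hG.f_one φ) h (hG.v_one φ))
  rcases h1 with h1 | h1
  · exact Or.inl (Flag.ext hf h1 hv)
  · exact Or.inr (Flag.ext (hf.trans (hG.f_one φ).symm) (h1.trans (h2.resolve_left h3).symm)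
      (hv.trans (hG.v_one φ).symm))

/-- The flags of one face form a single orbit, since the boundary of a polygon is connected. -/
theorem joined_of_face_eq (hG : K.IsCompatible G) {φ ψ : K.Flag} (h : φ.f = ψ.f) :
    G.Joined {0, 1} φ ψ := by
  have c := faceChart φ.hf
  have hzero : ∀ χ ω : K.Flag, χ.f = φ.f → ω.f = φ.f → ω.e = χ.e → G.Joined {0, 1} χ ω := by
    intro χ ω hχ hω he
    rcases hG.eq_or_eq_zero (hω.trans hχ.symm) he with rfl | rfl
    · exact .refl _
    · exact .step (by simp) _
  obtain ⟨k₀, hk₀⟩ := c.exists_side_eq φ.he φ.hef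
  obtain ⟨k₁, hk₁⟩ := c.exists_side_eq ψ.he (h ▸ ψ.hef)
  refine forall_sides (n := c.n) c.three_le (k₀ := k₀)
    (T := fun k => ∀ χ : K.Flag, χ.f = φ.f → χ.e = c.h '' polygonSide c.n k →
      G.Joined {0, 1} φ χ) ?_ ?_ k₁ ψ h.symm hk₁.symm
  · exact fun χ hχ hχe => hzero φ χ rfl hχ (hχe.trans hk₀)
  · rintro k l ⟨p, hpk, hpl⟩ hk χ hχ hχe
    by_cases hkl : k = l
    · exact hk χ hχ (hkl ▸ hχe)
    have hpV := c.mem_V_of_two_sides hkl hpk hpl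
    let α : K.Flag := ⟨φ.f, c.h '' polygonSide c.n k, c.h p, φ.hf, c.side_mem k, hpV,
      c.side_subset k, mem_image_of_mem _ hpk⟩
    let β : K.Flag := ⟨φ.f, c.h '' polygonSide c.n l, c.h p, φ.hf, c.side_mem l, hpV,
      c.side_subset l, mem_image_of_mem _ hpl⟩
    have hαβ : G.Joined {0, 1} α β := by
      rcases hG.eq_or_eq_one (φ := α) (ψ := β) rfl rfl with h | h
      · rw [h]; exact .refl _
      · rw [h]; exact .step (by simp) _
    exact ((hk α rfl rfl).trans hαβ).trans (hzero β χ rfl hχ hχe)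

/-- In a set of faces that is a union of pairs at each edge, each edge has even degree. -/
theorem even_ncard (hG : K.IsCompatible G) {A : Set (Set X)} (hA : A ⊆ K.F)
    (hclosed : ∀ φ : K.Flag, φ.f ∈ A → (G.s 2 φ).f ∈ A) (he : e ∈ K.E) :
    Even {f ∈ A | e ⊆ f}.ncard := by
  obtain ⟨v, hv, hve⟩ := exists_vertex he
  let flag : ∀ f ∈ {f ∈ A | e ⊆ f}, K.Flag := fun f hf => ⟨f, e, v, hA hf.1, he, hv, hf.2, hve⟩
  have hmem : ∀ f hf, (G.s 2 (flag f hf)).f ∈ {f ∈ A | e ⊆ f} := fun f hf =>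
    ⟨hclosed _ hf.1, (hG.e_two (flag f hf)).symm.subset.trans (G.s 2 (flag f hf)).hef⟩
  refine even_ncard_of_involution ((K.finite_F.subset hA).subset fun f hf => hf.1)
    (fun f hf => (G.s 2 (flag f hf)).f) hmem ?_ ?_
  · exact fun f hf h => G.ne 2 (flag f hf) (Flag.ext h (hG.e_two _) (hG.v_two _))
  · intro f hf
    have h : flag _ (hmem f hf) = G.s 2 (flag f hf) :=
      Flag.ext rfl (hG.e_two (flag f hf)).symm (hG.v_two (flag f hf)).symm
    change (G.s 2 (flag _ (hmem f hf))).f = f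
    rw [h, G.invol]

end IsCompatible

/-- The subcomplex that consists of a set `A` of faces, the edges of these faces, and all
vertices. -/
def restrict (K : TwoComplex X) (A : Set (Set X)) (hA : A ⊆ K.F) : TwoComplex X where
  V := K.V
  E := {e ∈ K.E | ∃ f ∈ A, e ⊆ f}
  F := A
  finite_V := K.finite_V
  finite_E := K.finite_E.subset fun _ he => he.1
  finite_F := K.finite_F.subset hA
  edge_cell e he := K.edge_cell e he.1
  edge_inter e he e' he' := K.edge_inter e he.1 e' he'.1
  face_cell f hf := by
    have c := faceChart (hA hf)
    refine ⟨c.n, c.three_le, c.h, c.isEmbedding, c.image_eq,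
      fun k => ⟨c.side_mem k, f, hf, c.side_subset k⟩, fun z hz h => c.mem_side z hz ?_⟩
    exact h.imp id fun ⟨e, he, hze⟩ => ⟨e, he.1, hze⟩
  face_inter f hf f' hf' hne := by
    rintro x ⟨hx, hx'⟩
    have h := K.face_inter f (hA hf) f' (hA hf') hne ⟨hx, hx'⟩
    have c := faceChart (hA hf)
    rw [← c.image_eq] at hx
    obtain ⟨z, hz, rfl⟩ := hx
    obtain ⟨k, hk⟩ := c.mem_side z hz h
    exact Or.inr ⟨_, ⟨c.side_mem k, f, hf, c.side_subset k⟩, mem_image_of_mem _ hk⟩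

theorem IsCompatible.isEven_restrict {G : FlagSystem K.Flag} (hG : K.IsCompatible G)
    {A : Set (Set X)} (hA : A ⊆ K.F) (hclosed : ∀ φ : K.Flag, φ.f ∈ A → (G.s 2 φ).f ∈ A) :
    (K.restrict A hA).IsEven := by
  rintro e ⟨he, f, hf, hef⟩
  refine ⟨?_, hG.even_ncard hA hclosed he⟩
  exact (ncard_pos ((K.finite_F.subset hA).subset fun f hf => hf.1)).2 ⟨f, hf, hef⟩

/-- The flags of a circlet form a single orbit: otherwise, the faces of the flags of one orbit and
the remaining faces would give a decomposition of the circlet. -/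
theorem IsCompatible.joined_of_isCirclet {G : FlagSystem K.Flag} (hG : K.IsCompatible G)
    (hK : K.IsCirclet) (φ ψ : K.Flag) : G.Joined univ φ ψ := by
  by_contra hφψ
  set A : Set (Set X) := {f ∈ K.F | ∃ χ : K.Flag, χ.f = f ∧ G.Joined univ φ χ} with hAdef
  have hA : A ⊆ K.F := fun f hf => hf.1
  have hB : K.F \ A ⊆ K.F := sdiff_subset
  have hmemA : ∀ χ : K.Flag, χ.f ∈ A ↔ G.Joined univ φ χ := by
    intro χ
    constructor
    · rintro ⟨-, ω, hω, h⟩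
      exact h.trans ((hG.joined_of_face_eq hω).mono (subset_univ _))
    · exact fun h => ⟨χ.hf, χ, rfl, h⟩
  have hAc : ∀ χ : K.Flag, χ.f ∈ A → (G.s 2 χ).f ∈ A := fun χ h =>
    (hmemA _).2 (((hmemA χ).1 h).trans (.step (mem_univ _) _))
  have hBc : ∀ χ : K.Flag, χ.f ∈ K.F \ A → (G.s 2 χ).f ∈ K.F \ A := fun χ h =>
    ⟨(G.s 2 χ).hf, fun h' => h.2 (by simpa [G.invol] using hAc _ h')⟩
  refine hK.2.2 ⟨K.restrict A hA, K.restrict (K.F \ A) hB, hG.isEven_restrict hA hAc,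
    hG.isEven_restrict hB hBc, ⟨φ.f, (hmemA φ).2 (.refl _)⟩,
    ⟨ψ.f, ψ.hf, fun h => hφψ ((hmemA ψ).1 h)⟩, union_self _, ?_, union_sdiff_cancel hA,
    disjoint_sdiff_right⟩
  refine Subset.antisymm (union_subset (fun e he => he.1) fun e he => he.1) fun e he => ?_
  obtain ⟨f, hf, hef⟩ :=
    (ncard_pos (K.finite_F.subset (fun f hf => hf.1 : {f ∈ K.F | e ⊆ f} ⊆ K.F))).1 (hK.1 e he).1
  by_cases hfA : f ∈ A
  · exact Or.inl ⟨he, f, hfA, hef⟩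
  · exact Or.inr ⟨he, f, ⟨hf, hfA⟩, hef⟩

end TwoComplex

/-! ### The developing map -/

theorem continuousOn_invFunOn {α β γ : Type*} [TopologicalSpace α] [TopologicalSpace β]
    [TopologicalSpace γ] [Nonempty α] {h : α → β} {S : Set α}
    (hh : IsEmbedding (S.domRestrict h)) {g : γ → β} {A : Set γ} (hg : ContinuousOn g A)
    (hm : MapsTo g A (h '' S)) : ContinuousOn (fun t => Function.invFunOn h S (g t)) A := by
  rw [continuousOn_iff_continuous_domRestrict] at hg ⊢
  let F : A → S := fun t => ⟨Function.invFunOn h S (g t), Function.invFunOn_mem (hm t.2)⟩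
  have hF : S.domRestrict h ∘ F = A.domRestrict g :=
    funext fun t => Function.invFunOn_eq (hm t.2)
  have hFc : Continuous F := hh.continuous_iff.2 (hF ▸ hg)
  exact continuous_subtype_val.comp hFc

theorem isEmbedding_invFunOn {α β γ : Type*} [TopologicalSpace α] [TopologicalSpace β]
    [TopologicalSpace γ] [Nonempty α] {h : α → β} {S : Set α}
    (hh : IsEmbedding (S.domRestrict h)) {g : γ → β} {A : Set γ}
    (hg : IsEmbedding (A.domRestrict g)) (hm : MapsTo g A (h '' S)) :
    IsEmbedding (A.domRestrict fun t => Function.invFunOn h S (g t)) := by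
  let F : A → S := fun t => ⟨Function.invFunOn h S (g t), Function.invFunOn_mem (hm t.2)⟩
  have hF : S.domRestrict h ∘ F = A.domRestrict g :=
    funext fun t => Function.invFunOn_eq (hm t.2)
  have hFc : Continuous F := hh.continuous_iff.2 (hF ▸ hg.continuous)
  have hFe : IsEmbedding F := .of_comp hFc hh.continuous (hF ▸ hg)
  exact IsEmbedding.subtypeVal.comp hFe

theorem isEmbedding_domRestrict_of_isCompact {α β : Type*} [TopologicalSpace α]
    [TopologicalSpace β] [T2Space β] {h : α → β} {S : Set α} (hS : IsCompact S)
    (hc : Continuous h) (hi : InjOn h S) : IsEmbedding (S.domRestrict h) := by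
  have := isCompact_iff_compactSpace.1 hS
  have hc' : Continuous (S.domRestrict h) := hc.comp continuous_subtype_val
  exact (hc'.isClosedEmbedding (injOn_iff_injective.1 hi)).isEmbedding

namespace TwoComplex

variable {X : Type u} [TopologicalSpace X] {K : TwoComplex X}

open scoped Classical in
/-- The half of the edge of a flag from the vertex of the flag (at parameter `0`) to the midpoint of
the edge (at parameter `1`). -/
noncomputable def Flag.halfEdge (φ : K.Flag) (t : ℝ) : X :=
  if φ.v = (edgeChart φ.he).h 0 then (edgeChart φ.he).h (t / 2)
  else (edgeChart φ.he).h (1 - t / 2)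

/-- The half-edge of a flag, in the coordinates of the polygon that parametrizes the face. -/
noncomputable def Flag.curve (φ : K.Flag) (t : ℝ) : ℂ :=
  Function.invFunOn (faceChart φ.hf).h (regularPolygon (faceChart φ.hf).n) (φ.halfEdge t)

/-- The map from the triangle of a flag to its face: the cone, from the centre of the polygon that
parametrizes the face, over the half-edge of the flag. -/
noncomputable def develop (p : K.Flag × stdSimplex ℝ (Fin 3)) : X :=
  (faceChart p.1.hf).h (cone p.1.curve (p.2 0) (p.2 1))

namespace Flag

theorem edgeChart_eq {e e' : Set X} (he : e ∈ K.E) (he' : e' ∈ K.E) (h : e = e') :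
    (edgeChart he).h = (edgeChart he').h := by
  subst h; rfl

variable (φ : K.Flag)

theorem halfEdge_cases :
    (φ.v = (edgeChart φ.he).h 0 ∧ ∀ t, φ.halfEdge t = (edgeChart φ.he).h (t / 2)) ∨
    (φ.v = (edgeChart φ.he).h 1 ∧ ∀ t, φ.halfEdge t = (edgeChart φ.he).h (1 - t / 2)) := by
  by_cases h : φ.v = (edgeChart φ.he).h 0
  · exact Or.inl ⟨h, fun t => if_pos h⟩
  · exact Or.inr ⟨((edgeChart φ.he).eq_or_eq φ.hv φ.hve).resolve_left h, fun t => if_neg h⟩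

theorem half_mem_Icc {t : ℝ} (ht : t ∈ Icc (0 : ℝ) 1) :
    t / 2 ∈ Icc (0 : ℝ) 1 ∧ 1 - t / 2 ∈ Icc (0 : ℝ) 1 := by
  obtain ⟨h0, h1⟩ := ht
  exact ⟨⟨by linarith, by linarith⟩, ⟨by linarith, by linarith⟩⟩

theorem halfEdge_mem {t : ℝ} (ht : t ∈ Icc (0 : ℝ) 1) : φ.halfEdge t ∈ φ.e := by
  rcases φ.halfEdge_cases with ⟨-, h⟩ | ⟨-, h⟩ <;> rw [h]
  · exact (edgeChart φ.he).mem (half_mem_Icc ht).1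
  · exact (edgeChart φ.he).mem (half_mem_Icc ht).2

theorem halfEdge_zero : φ.halfEdge 0 = φ.v := by
  rcases φ.halfEdge_cases with ⟨hv, h⟩ | ⟨hv, h⟩ <;> rw [h, hv] <;> simp

theorem continuousOn_halfEdge : ContinuousOn φ.halfEdge (Icc 0 1) := by
  have hc : ContinuousOn (edgeChart φ.he).h (Icc 0 1) :=
    continuousOn_iff_continuous_domRestrict.2 (edgeChart φ.he).isEmbedding.continuous
  rcases φ.halfEdge_cases with ⟨-, h⟩ | ⟨-, h⟩
  · exact (hc.comp (by fun_prop : ContinuousOn (fun t : ℝ => t / 2) (Icc 0 1))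
      fun t ht => (half_mem_Icc ht).1).congr fun t _ => h t
  · exact (hc.comp (by fun_prop : ContinuousOn (fun t : ℝ => 1 - t / 2) (Icc 0 1))
      fun t ht => (half_mem_Icc ht).2).congr fun t _ => h t

variable {φ} {ψ : K.Flag}

theorem halfEdge_eq (he : φ.e = ψ.e) (hv : φ.v = ψ.v) : φ.halfEdge = ψ.halfEdge := by
  obtain ⟨⟩ := φ
  obtain ⟨⟩ := ψ
  subst he hv
  rfl

theorem halfEdge_one_eq (he : φ.e = ψ.e) : φ.halfEdge 1 = ψ.halfEdge 1 := by
  have h2 : (1 - 1 / 2 : ℝ) = 1 / 2 := by norm_num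
  simp only [halfEdge, edgeChart_eq φ.he ψ.he he, h2, ite_self]

theorem halfEdge_mem_V {t : ℝ} (ht : t ∈ Icc (0 : ℝ) 1) : φ.halfEdge t ∈ K.V ↔ t = 0 := by
  constructor
  · intro hV
    obtain ⟨h0, h1⟩ := ht
    rcases φ.halfEdge_cases with ⟨-, h⟩ | ⟨-, h⟩ <;> rw [h] at hV
    · rcases ((edgeChart φ.he).mem_V _ (half_mem_Icc ⟨h0, h1⟩).1).1 hV with h | h <;> linarith
    · rcases ((edgeChart φ.he).mem_V _ (half_mem_Icc ⟨h0, h1⟩).2).1 hV with h | h <;> linarith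
  · rintro rfl
    rw [halfEdge_zero]
    exact φ.hv

theorem eq_of_halfEdge_eq {t t' : ℝ} (ht : t ∈ Icc (0 : ℝ) 1) (ht' : t' ∈ Icc (0 : ℝ) 1)
    (h : φ.halfEdge t = ψ.halfEdge t') :
    t = t' ∧ (φ.e = ψ.e ∧ φ.v = ψ.v ∨ t = 0 ∧ φ.v = ψ.v ∨ t = 1 ∧ φ.e = ψ.e) := by
  by_cases he : φ.e = ψ.e
  · have hc := edgeChart_eq φ.he ψ.he he
    have hinj := (edgeChart ψ.he).injOn
    have m := half_mem_Icc ht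
    have m' := half_mem_Icc ht'
    obtain ⟨h0, h1⟩ := ht
    obtain ⟨h0', h1'⟩ := ht'
    rcases φ.halfEdge_cases with ⟨hv, h2⟩ | ⟨hv, h2⟩ <;>
      rcases ψ.halfEdge_cases with ⟨hv', h2'⟩ | ⟨hv', h2'⟩ <;>
      rw [h2, h2', hc] at h <;> rw [hc] at hv
    · have := hinj m.1 m'.1 h
      exact ⟨by linarith, Or.inl ⟨he, hv.trans hv'.symm⟩⟩
    · have := hinj m.1 m'.2 h
      exact ⟨by linarith, Or.inr (Or.inr ⟨by linarith, he⟩)⟩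
    · have := hinj m.2 m'.1 h
      exact ⟨by linarith, Or.inr (Or.inr ⟨by linarith, he⟩)⟩
    · have := hinj m.2 m'.2 h
      exact ⟨by linarith, Or.inl ⟨he, hv.trans hv'.symm⟩⟩
  · have hV : φ.halfEdge t ∈ K.V :=
      K.edge_inter _ φ.he _ ψ.he he ⟨φ.halfEdge_mem ht, h ▸ ψ.halfEdge_mem ht'⟩
    have h0 := (halfEdge_mem_V ht).1 hV
    have h0' := (halfEdge_mem_V ht').1 (h ▸ hV)
    subst h0 h0'
    rw [halfEdge_zero, halfEdge_zero] at h
    exact ⟨rfl, Or.inr (Or.inl ⟨rfl, h⟩)⟩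

/-- The half-edges of the flags of an edge of a face cover the edge. -/
theorem exists_halfEdge_eq {f e : Set X} (hf : f ∈ K.F) (he : e ∈ K.E) (hef : e ⊆ f) {x : X}
    (hx : x ∈ e) : ∃ φ : K.Flag, φ.f = f ∧ φ.e = e ∧ ∃ t ∈ Icc (0 : ℝ) 1, φ.halfEdge t = x := by
  set c := edgeChart he with hc
  have m0 : (0 : ℝ) ∈ Icc (0 : ℝ) 1 := ⟨le_rfl, zero_le_one⟩
  have m1 : (1 : ℝ) ∈ Icc (0 : ℝ) 1 := ⟨zero_le_one, le_rfl⟩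
  obtain ⟨t, ⟨ht0, ht1⟩, rfl⟩ := c.image_eq.symm.subset hx
  rcases le_total t (1 / 2) with ht | ht
  · let φ : K.Flag := ⟨f, e, c.h 0, hf, he, (c.mem_V 0 m0).2 (Or.inl rfl), hef, c.mem m0⟩
    refine ⟨φ, rfl, rfl, 2 * t, ⟨by linarith, by linarith⟩, ?_⟩
    rw [halfEdge, if_pos rfl]
    change c.h (2 * t / 2) = c.h t
    rw [mul_div_cancel_left₀ _ two_ne_zero]
  · let φ : K.Flag := ⟨f, e, c.h 1, hf, he, (c.mem_V 1 m1).2 (Or.inr rfl), hef, c.mem m1⟩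
    refine ⟨φ, rfl, rfl, 2 * (1 - t), ⟨by linarith, by linarith⟩, ?_⟩
    rw [halfEdge, if_neg c.zero_ne_one.symm]
    change c.h (1 - 2 * (1 - t) / 2) = c.h t
    congr 1
    ring

theorem halfEdge_mem_image {t : ℝ} (ht : t ∈ Icc (0 : ℝ) 1) :
    φ.halfEdge t ∈ (faceChart φ.hf).h '' regularPolygon (faceChart φ.hf).n :=
  (faceChart φ.hf).image_eq.symm.subset (φ.hef (φ.halfEdge_mem ht))

theorem chart_curve {t : ℝ} (ht : t ∈ Icc (0 : ℝ) 1) :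
    (faceChart φ.hf).h (φ.curve t) = φ.halfEdge t :=
  Function.invFunOn_eq (halfEdge_mem_image ht)

theorem curve_mem {t : ℝ} (ht : t ∈ Icc (0 : ℝ) 1) :
    φ.curve t ∈ regularPolygon (faceChart φ.hf).n :=
  Function.invFunOn_mem (halfEdge_mem_image ht)

theorem curve_mem_side {t : ℝ} (ht : t ∈ Icc (0 : ℝ) 1) :
    ∃ k, φ.curve t ∈ polygonSide (faceChart φ.hf).n k :=
  (faceChart φ.hf).mem_side _ (curve_mem ht)
    (by rw [chart_curve ht]; exact Or.inr ⟨φ.e, φ.he, φ.halfEdge_mem ht⟩)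

theorem continuousOn_curve : ContinuousOn φ.curve (Icc 0 1) :=
  continuousOn_invFunOn (faceChart φ.hf).isEmbedding φ.continuousOn_halfEdge
    fun _ ht => halfEdge_mem_image ht

theorem curve_eq_curve {t : ℝ} (hf : φ.f = ψ.f) (h : φ.halfEdge t = ψ.halfEdge t) :
    φ.curve t = ψ.curve t := by
  have key : ∀ {f f' : Set X} (hf : f ∈ K.F) (hf' : f' ∈ K.F) (x : X), f = f' →
      Function.invFunOn (faceChart hf).h (regularPolygon (faceChart hf).n) x =
      Function.invFunOn (faceChart hf').h (regularPolygon (faceChart hf').n) x := by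
    rintro f _ hf hf' x rfl
    rfl
  rw [curve, curve, h]
  exact key φ.hf ψ.hf _ hf

theorem chart_eq_chart (hf : φ.f = ψ.f) : (faceChart φ.hf).h = (faceChart ψ.hf).h := by
  have key : ∀ {f f' : Set X} (hf : f ∈ K.F) (hf' : f' ∈ K.F), f = f' →
      (faceChart hf).h = (faceChart hf').h := by
    rintro f _ hf hf' rfl
    rfl
  exact key φ.hf ψ.hf hf

theorem polygon_eq_polygon (hf : φ.f = ψ.f) : (faceChart φ.hf).n = (faceChart ψ.hf).n := by
  have key : ∀ {f f' : Set X} (hf : f ∈ K.F) (hf' : f' ∈ K.F), f = f' →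
      (faceChart hf).n = (faceChart hf').n := by
    rintro f _ hf hf' rfl
    rfl
  exact key φ.hf ψ.hf hf

theorem cone_mem {a b : ℝ} (ha : 0 ≤ a) (hb : 0 ≤ b) (hab : a + b ≤ 1) :
    cone φ.curve a b ∈ regularPolygon (faceChart φ.hf).n :=
  mul_mem_regularPolygon (curve_mem (div_add_mem_Icc ha hb)) ⟨add_nonneg ha hb, hab⟩

end Flag

open FlagSystem

theorem isTriple_two : IsTriple 2 0 1 := ⟨by decide, by decide, by decide⟩

theorem cone_coord_mem (φ : K.Flag) (x : stdSimplex ℝ (Fin 3)) :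
    cone φ.curve (x 0) (x 1) ∈ regularPolygon (faceChart φ.hf).n := by
  have h2 : 0 ≤ x 2 := x.2.1 2
  exact Flag.cone_mem (x.2.1 0) (x.2.1 1) (by linarith [isTriple_two.sum_eq x])

theorem develop_mem (p : K.Flag × stdSimplex ℝ (Fin 3)) : develop p ∈ p.1.f :=
  (faceChart p.1.hf).mem (cone_coord_mem p.1 p.2)

theorem continuous_develop : Continuous (develop : K.Flag × stdSimplex ℝ (Fin 3) → X) := by
  rw [continuous_prod_of_discrete_left]
  intro φ
  have hc : ContinuousOn (faceChart φ.hf).h (regularPolygon (faceChart φ.hf).n) :=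
    continuousOn_iff_continuous_domRestrict.2 (faceChart φ.hf).isEmbedding.continuous
  exact hc.comp_continuous (continuous_cone_coord Flag.continuousOn_curve 0 1)
    (cone_coord_mem φ)

/-- On the outer wall of the triangle of a flag, the developing map is the half-edge. -/
theorem develop_of_eq_zero {φ : K.Flag} {x : stdSimplex ℝ (Fin 3)} (hx : x 2 = 0) :
    develop (φ, x) = φ.halfEdge (x 1) := by
  have hsum : x 0 + x 1 = 1 := by linarith [isTriple_two.sum_eq x]
  have h0 : 0 ≤ x 0 := x.2.1 0
  have h1 : 0 ≤ x 1 := x.2.1 1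
  have hm : x 1 ∈ Icc (0 : ℝ) 1 := ⟨h1, by linarith⟩
  simp only [develop, cone, hsum, Complex.ofReal_one, one_mul, div_one]
  exact Flag.chart_curve hm

theorem coord_mem_Icc (x : stdSimplex ℝ (Fin 3)) (i : Fin 3) : x i ∈ Icc (0 : ℝ) 1 :=
  ⟨x.2.1 i, stdSimplex.le_one x i⟩

theorem develop_mem_skeleton_iff {φ : K.Flag} {x : stdSimplex ℝ (Fin 3)} :
    develop (φ, x) ∈ K.V ∪ ⋃₀ K.E ↔ x 2 = 0 := by
  constructor
  · intro h
    obtain ⟨k, hk⟩ := (faceChart φ.hf).mem_side _ (cone_coord_mem φ x) h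
    have h0 : 0 ≤ x 0 := x.2.1 0
    have h1 : 0 ≤ x 1 := x.2.1 1
    obtain ⟨l, hl⟩ := Flag.curve_mem_side (φ := φ) (div_add_mem_Icc h0 h1)
    have := eq_one_of_mul_side_mem hl (add_nonneg h0 h1) hk
    linarith [isTriple_two.sum_eq x]
  · intro h
    rw [develop_of_eq_zero h]
    exact Or.inr ⟨φ.e, φ.he, φ.halfEdge_mem (coord_mem_Icc x 1)⟩

theorem develop_mem_V_iff {φ : K.Flag} {x : stdSimplex ℝ (Fin 3)} :
    develop (φ, x) ∈ K.V ↔ x 2 = 0 ∧ x 1 = 0 := by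
  constructor
  · intro h
    have h2 := develop_mem_skeleton_iff.1 (Or.inl h)
    rw [develop_of_eq_zero h2, Flag.halfEdge_mem_V (coord_mem_Icc x 1)] at h
    exact ⟨h2, h⟩
  · rintro ⟨h2, h1⟩
    rw [develop_of_eq_zero h2, Flag.halfEdge_mem_V (coord_mem_Icc x 1), h1]

namespace IsCompatible

variable {G : FlagSystem K.Flag}

theorem develop_eq_of_gluing (hG : K.IsCompatible G) {p q : K.Flag × stdSimplex ℝ (Fin 3)}
    (h : G.gluing p q) : develop p = develop q := by
  obtain ⟨φ, x⟩ := p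
  obtain ⟨ψ, y⟩ := q
  obtain ⟨rfl, h⟩ := h
  simp only at h
  induction h with
  | refl => rfl
  | @tail χ _ _ hi ih =>
    obtain ⟨i, hi, rfl⟩ := hi
    have hi : x i = 0 := hi
    rw [ih]
    fin_cases i
    · have hf := hG.f_zero χ
      have h := Flag.curve_eq_curve (t := 1) hf (Flag.halfEdge_one_eq (hG.e_zero χ))
      simp only [develop]
      rw [Flag.chart_eq_chart hf.symm]
      exact congrArg _ (cone_eq_of_left_eq_zero h.symm hi)
    · have hf := hG.f_one χ
      have h := Flag.curve_eq_curve (t := 0) hf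
        (by rw [Flag.halfEdge_zero, Flag.halfEdge_zero, hG.v_one])
      simp only [develop]
      rw [Flag.chart_eq_chart hf.symm]
      exact congrArg _ (cone_eq_of_right_eq_zero h.symm hi)
    · rw [develop_of_eq_zero hi, develop_of_eq_zero hi]
      exact congrFun (Flag.halfEdge_eq (hG.e_two χ).symm (hG.v_two χ).symm) _

/-- On the triangles of a single face, the developing map identifies only points that are glued. -/
theorem eq_and_joined_of_develop_eq (hG : K.IsCompatible G) {φ ψ : K.Flag}
    {x y : stdSimplex ℝ (Fin 3)} (hf : φ.f = ψ.f) (h : develop (φ, x) = develop (ψ, y)) :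
    x = y ∧ G.Joined ({i | x i = 0} ∩ {0, 1}) φ ψ := by
  have hcone : cone φ.curve (x 0) (x 1) = cone ψ.curve (y 0) (y 1) := by
    have hy := cone_coord_mem ψ y
    rw [← Flag.polygon_eq_polygon hf] at hy
    refine (faceChart φ.hf).injOn (cone_coord_mem φ x) hy ?_
    simp only [develop] at h
    rw [h, Flag.chart_eq_chart hf]
  refine eq_and_joined_of_cone_eq isTriple_two (O := {χ | χ.f = φ.f}) (γ := Flag.curve)
    (fun χ hχ ω hω => hG.joined_of_face_eq (hχ.trans hω.symm)) ?_ ?_ rfl hf.symm hcone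
  · intro χ hχ ω hω t ht t' ht' r r' hr hr' e
    obtain ⟨k, hk⟩ := Flag.curve_mem_side (φ := χ) ht
    obtain ⟨l, hl⟩ := Flag.curve_mem_side (φ := ω) ht'
    have hn : (faceChart ω.hf).n = (faceChart χ.hf).n :=
      Flag.polygon_eq_polygon (hω.trans hχ.symm)
    have key : ∀ {m n : ℕ} (l : Fin m) (z : ℂ), m = n → z ∈ polygonSide m l →
        ∃ l' : Fin n, z ∈ polygonSide n l' := by
      rintro m _ l z rfl h
      exact ⟨l, h⟩
    obtain ⟨l', hl'⟩ := key l _ hn hl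
    exact eq_of_mul_side_eq hk hl' hr hr' e
  · intro χ hχ ω hω t ht t' ht' e
    have hχω : χ.f = ω.f := hχ.trans hω.symm
    have e' := congrArg (faceChart χ.hf).h e
    rw [Flag.chart_curve ht, Flag.chart_eq_chart hχω, Flag.chart_curve ht'] at e'
    obtain ⟨rfl, h1 | h1 | h1⟩ := Flag.eq_of_halfEdge_eq ht ht' e'
    · exact ⟨rfl, Or.inl (Flag.ext hχω h1.1 h1.2)⟩
    · rcases hG.eq_or_eq_one hχω.symm h1.2.symm with h2 | h2
      · exact ⟨rfl, Or.inl h2.symm⟩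
      · exact ⟨rfl, Or.inr (Or.inl ⟨h1.1, h2⟩)⟩
    · rcases hG.eq_or_eq_zero hχω.symm h1.2.symm with h2 | h2
      · exact ⟨rfl, Or.inl h2.symm⟩
      · exact ⟨rfl, Or.inr (Or.inr ⟨h1.1, h2⟩)⟩

end IsCompatible

/-- Every point of an edge of a face lies on the outer wall of the triangle of some flag. -/
theorem exists_develop_eq_of_edge {f e : Set X} (hf : f ∈ K.F) (he : e ∈ K.E) (hef : e ⊆ f)
    {x : X} (hx : x ∈ e) : ∃ (φ : K.Flag) (y : stdSimplex ℝ (Fin 3)), φ.f = f ∧ φ.e = e ∧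
      y 2 = 0 ∧ develop (φ, y) = x := by
  obtain ⟨φ, hφf, hφe, t, ht, rfl⟩ := Flag.exists_halfEdge_eq hf he hef hx
  obtain ⟨y, hy2, hy0, hy1⟩ := isTriple_two.exists_point (a := 1 - t) (b := t)
    (by linarith [ht.2]) ht.1 (by linarith)
  have hy2' : y 2 = 0 := by linarith
  exact ⟨φ, y, hφf, hφe, hy2', by rw [develop_of_eq_zero hy2', hy1]⟩

/-- The triangles of the flags of a face cover the face. -/
theorem exists_develop_eq {f : Set X} (hf : f ∈ K.F) {x : X} (hx : x ∈ f) :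
    ∃ (φ : K.Flag) (y : stdSimplex ℝ (Fin 3)), φ.f = f ∧ develop (φ, y) = x := by
  obtain ⟨z, hz, rfl⟩ := (faceChart hf).image_eq.symm.subset hx
  obtain ⟨k, b, hb, r, ⟨hr0, hr1⟩, rfl⟩ := exists_mul_side_eq (faceChart hf).three_le hz
  obtain ⟨φ, hφf, -, t, ht, hφt⟩ := Flag.exists_halfEdge_eq hf ((faceChart hf).side_mem k)
    ((faceChart hf).side_subset k) (mem_image_of_mem _ hb)
  obtain ⟨y, -, hy0, hy1⟩ := isTriple_two.exists_point (a := r * (1 - t)) (b := r * t)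
    (mul_nonneg hr0 (by linarith [ht.2])) (mul_nonneg hr0 ht.1) (by linarith)
  subst hφf
  refine ⟨φ, y, rfl, ?_⟩
  have hcurve : φ.curve t = b :=
    (faceChart φ.hf).injOn (Flag.curve_mem ht) hb.1 ((Flag.chart_curve ht).trans hφt)
  have hsum : r * (1 - t) + r * t = r := by ring
  simp only [develop, cone, hy0, hy1, hsum]
  by_cases hr : r = 0
  · simp [hr]
  · rw [mul_div_cancel_left₀ _ hr, hcurve]

end TwoComplex

/-! ### The Euler cover -/

namespace TwoComplex

open FlagSystem

variable {X : Type u} [TopologicalSpace X] {K : TwoComplex X} {G : FlagSystem K.Flag}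

/-- The developing map on the surface obtained by gluing the triangles of all flags. -/
noncomputable def IsCompatible.cover (hG : K.IsCompatible G) : G.Realization → X :=
  Quotient.lift develop fun _ _ => hG.develop_eq_of_gluing

/-- The face of the surface over the face `f` of `K`. -/
def faceCell (G : FlagSystem K.Flag) (f : Set X) : Set G.Realization :=
  G.proj '' {p | p.1.f = f}

/-- The edge of the surface that belongs to a flag: the union of the outer walls of the two
triangles that have the same face and edge. -/
def edgeCell (G : FlagSystem K.Flag) (φ : K.Flag) : Set G.Realization :=
  G.proj '' {p | p.1.f = φ.f ∧ p.1.e = φ.e ∧ p.2 2 = 0}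

theorem edgeCell_subset (φ : K.Flag) : edgeCell G φ ⊆ faceCell G φ.f :=
  image_mono fun _ hp => hp.1

theorem edgeCell_congr {φ ψ : K.Flag} (hf : φ.f = ψ.f) (he : φ.e = ψ.e) :
    edgeCell G φ = edgeCell G ψ := by
  simp only [edgeCell, hf, he]

theorem isCompact_faceCell (f : Set X) : IsCompact (faceCell G f) := by
  refine IsCompact.image (IsClosed.isCompact ?_) G.continuous_proj
  exact (isClosed_discrete {φ : K.Flag | φ.f = f}).preimage continuous_fst

theorem isCompact_edgeCell (φ : K.Flag) : IsCompact (edgeCell G φ) := by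
  refine IsCompact.image (IsClosed.isCompact ?_) G.continuous_proj
  have h1 : IsClosed {p : K.Flag × stdSimplex ℝ (Fin 3) | p.1 ∈ {ψ : K.Flag | ψ.f = φ.f}} :=
    (isClosed_discrete _).preimage continuous_fst
  have h2 : IsClosed {p : K.Flag × stdSimplex ℝ (Fin 3) | p.1 ∈ {ψ : K.Flag | ψ.e = φ.e}} :=
    (isClosed_discrete _).preimage continuous_fst
  have h3 : IsClosed {p : K.Flag × stdSimplex ℝ (Fin 3) | p.2 2 = 0} :=
    isClosed_eq ((continuous_coord 2).comp continuous_snd) continuous_const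
  exact h1.inter (h2.inter h3)

namespace IsCompatible

theorem cover_proj (hG : K.IsCompatible G) (p : K.Flag × stdSimplex ℝ (Fin 3)) :
    hG.cover (G.proj p) = develop p := rfl

theorem continuous_cover (hG : K.IsCompatible G) : Continuous hG.cover :=
  continuous_develop.quotient_lift _

theorem image_faceCell (hG : K.IsCompatible G) {f : Set X} (hf : f ∈ K.F) :
    hG.cover '' faceCell G f = f := by
  refine Subset.antisymm ?_ fun x hx => ?_
  · rintro _ ⟨_, ⟨p, hp, rfl⟩, rfl⟩
    rw [cover_proj]
    exact hp ▸ develop_mem p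
  · obtain ⟨φ, y, hφ, rfl⟩ := exists_develop_eq hf hx
    exact ⟨_, ⟨(φ, y), hφ, rfl⟩, rfl⟩

theorem image_edgeCell (hG : K.IsCompatible G) (φ : K.Flag) :
    hG.cover '' edgeCell G φ = φ.e := by
  refine Subset.antisymm ?_ fun x hx => ?_
  · rintro _ ⟨_, ⟨⟨ψ, y⟩, ⟨-, hp, hy⟩, rfl⟩, rfl⟩
    rw [cover_proj, develop_of_eq_zero hy, ← hp]
    exact ψ.halfEdge_mem (coord_mem_Icc y 1)
  · obtain ⟨ψ, y, hf, he, hy, rfl⟩ := exists_develop_eq_of_edge φ.hf φ.he φ.hef hx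
    exact ⟨_, ⟨(ψ, y), ⟨hf, he, hy⟩, rfl⟩, rfl⟩

theorem injOn_faceCell (hG : K.IsCompatible G) (f : Set X) : InjOn hG.cover (faceCell G f) := by
  rintro _ ⟨⟨φ, x⟩, hφ, rfl⟩ _ ⟨⟨ψ, y⟩, hψ, rfl⟩ h
  obtain ⟨h1, h2⟩ := hG.eq_and_joined_of_develop_eq (hφ.trans hψ.symm) h
  exact G.proj_eq_iff.2 ⟨h1, h2.mono inter_subset_left⟩

theorem isEmbedding_faceCell [T2Space X] (hG : K.IsCompatible G) (f : Set X) :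
    IsEmbedding ((faceCell G f).domRestrict hG.cover) :=
  isEmbedding_domRestrict_of_isCompact (isCompact_faceCell f) hG.continuous_cover
    (hG.injOn_faceCell f)

theorem isEmbedding_edgeCell [T2Space X] (hG : K.IsCompatible G) (φ : K.Flag) :
    IsEmbedding ((edgeCell G φ).domRestrict hG.cover) :=
  isEmbedding_domRestrict_of_isCompact (isCompact_edgeCell φ) hG.continuous_cover
    ((hG.injOn_faceCell φ.f).mono (edgeCell_subset φ))

theorem cover_mem_skeleton_iff (hG : K.IsCompatible G) (y : G.Realization) :
    hG.cover y ∈ K.V ∪ ⋃₀ K.E ↔ y ∈ hG.cover ⁻¹' K.V ∪ ⋃₀ range (edgeCell G) := by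
  constructor
  · obtain ⟨⟨φ, x⟩, rfl⟩ := G.proj_surjective y
    intro h
    exact Or.inr ⟨_, ⟨φ, rfl⟩, (φ, x), ⟨rfl, rfl, develop_mem_skeleton_iff.1 h⟩, rfl⟩
  · rintro (h | ⟨_, ⟨φ, rfl⟩, h⟩)
    · exact Or.inl h
    · exact Or.inr ⟨φ.e, φ.he, (hG.image_edgeCell φ).subset (mem_image_of_mem _ h)⟩

/-- The two ends of an edge, and the two faces paired at it, determine the same edge of the
surface. -/
theorem edgeCell_step (hG : K.IsCompatible G) {i : Fin 3} (hi : i ≠ 1) (φ : K.Flag) :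
    edgeCell G (G.s i φ) = edgeCell G φ := by
  have h2 : ∀ χ : K.Flag, edgeCell G χ ⊆ edgeCell G (G.s 2 χ) := by
    rintro χ _ ⟨⟨ψ, y⟩, ⟨hf, he, hy⟩, rfl⟩
    refine ⟨(G.s 2 ψ, y), ⟨hG.f_two _ _ hf he, ?_, hy⟩, ?_⟩
    · exact ((hG.e_two ψ).trans he).trans (hG.e_two χ).symm
    · exact G.proj_eq_iff.2 ⟨rfl, (Joined.step (by exact hy) ψ).symm⟩
  fin_cases i
  · exact edgeCell_congr (hG.f_zero φ) (hG.e_zero φ)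
  · exact absurd rfl hi
  · refine Subset.antisymm ?_ (h2 φ)
    have h := h2 (G.s 2 φ)
    rwa [G.invol] at h

theorem finite_vertices (hG : K.IsCompatible G) : (hG.cover ⁻¹' K.V).Finite := by
  have hsub : hG.cover ⁻¹' K.V ⊆ G.proj '' {p | p.2 2 = 0 ∧ p.2 1 = 0} := by
    intro y hy
    obtain ⟨⟨φ, x⟩, rfl⟩ := G.proj_surjective y
    exact ⟨(φ, x), develop_mem_V_iff.1 hy, rfl⟩
  refine Set.Finite.subset (Set.Finite.image _ ?_) hsub
  refine Set.Finite.of_finite_image (f := Prod.fst) (toFinite _) ?_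
  rintro ⟨φ, x⟩ ⟨h2, h1⟩ ⟨ψ, y⟩ ⟨h2', h1'⟩ h
  refine Prod.ext h (isTriple_two.ext ?_ (h1.trans h1'.symm))
  have := isTriple_two.sum_eq x
  have := isTriple_two.sum_eq y
  simp only at h2 h1 h2' h1' ⊢
  linarith

/-- The cell structure on the surface: its vertices are the points over the vertices of `K`. -/
noncomputable def surface [T2Space X] (hG : K.IsCompatible G) : TwoComplex G.Realization where
  V := hG.cover ⁻¹' K.V
  E := range (edgeCell G)
  F := faceCell G '' K.F
  finite_V := hG.finite_vertices
  finite_E := finite_range _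
  finite_F := K.finite_F.image _
  edge_cell := by
    rintro _ ⟨φ, rfl⟩
    have c := edgeChart φ.he
    have : Nonempty G.Realization := ⟨G.proj (φ, Classical.arbitrary _)⟩
    have hm : MapsTo c.h (Icc 0 1) (hG.cover '' edgeCell G φ) := fun t ht =>
      (hG.image_edgeCell φ).symm.subset (c.mem ht)
    refine ⟨fun t => Function.invFunOn hG.cover (edgeCell G φ) (c.h t),
      isEmbedding_invFunOn (hG.isEmbedding_edgeCell φ) c.isEmbedding hm, ?_, fun t ht => ?_⟩
    · rw [← image_image (Function.invFunOn hG.cover (edgeCell G φ)) c.h, c.image_eq,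
        ← hG.image_edgeCell φ]
      exact (injOn_iff_injective.2 (hG.isEmbedding_edgeCell φ).injective).invFunOn_image
        Subset.rfl
    · rw [mem_preimage, Function.invFunOn_eq (hm ht)]
      exact c.mem_V t ht
  edge_inter := by
    rintro _ ⟨φ, rfl⟩ _ ⟨ψ, rfl⟩ hne _ ⟨⟨⟨φ', x⟩, ⟨hf, he, hx⟩, rfl⟩, ⟨⟨ψ', y⟩, ⟨hf', he', -⟩, hxy⟩⟩
    obtain ⟨rfl, h⟩ := G.proj_eq_iff.1 hxy
    rw [← edgeCell_congr hf he, ← edgeCell_congr hf' he'] at hne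
    refine develop_mem_V_iff.2 ⟨hx, ?_⟩
    -- off the vertices, points of the outer walls are glued only by `s 0` and `s 2`
    by_contra hx1
    refine hne (h.map_eq (edgeCell G) fun i hi χ => hG.edgeCell_step ?_ χ)
    rintro rfl
    exact hx1 hi
  face_cell := by
    rintro _ ⟨f, hf, rfl⟩
    have c := faceChart hf
    have : Nonempty G.Realization := by
      obtain ⟨φ, -⟩ := exists_flag_of_face hf
      exact ⟨G.proj (φ, Classical.arbitrary _)⟩
    have hm : MapsTo c.h (regularPolygon c.n) (hG.cover '' faceCell G f) := fun z hz =>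
      (hG.image_faceCell hf).symm.subset (c.mem hz)
    refine ⟨c.n, c.three_le, fun z => Function.invFunOn hG.cover (faceCell G f) (c.h z),
      isEmbedding_invFunOn (hG.isEmbedding_faceCell f) c.isEmbedding hm, ?_, fun k => ?_,
      fun z hz h => ?_⟩
    · rw [← image_image (Function.invFunOn hG.cover (faceCell G f)) c.h, c.image_eq]
      nth_rw 2 [← hG.image_faceCell hf]
      exact (hG.injOn_faceCell f).invFunOn_image Subset.rfl
    · obtain ⟨φ, rfl, hφ⟩ := exists_flag_of_edge hf (c.side_mem k) (c.side_subset k)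
      refine ⟨φ, ?_⟩
      rw [← image_image (Function.invFunOn hG.cover (faceCell G φ.f)) c.h, ← hφ,
        ← hG.image_edgeCell φ]
      exact ((hG.injOn_faceCell φ.f).invFunOn_image (edgeCell_subset φ)).symm
    · have h := (hG.cover_mem_skeleton_iff _).2 h
      rw [Function.invFunOn_eq (hm hz)] at h
      exact c.mem_side z hz h
  face_inter := by
    rintro _ ⟨f, hf, rfl⟩ _ ⟨f', hf', rfl⟩ hne _ ⟨⟨⟨φ, x⟩, hφ, rfl⟩, ⟨⟨ψ, y⟩, hψ, hxy⟩⟩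
    obtain ⟨rfl, h⟩ := G.proj_eq_iff.1 hxy
    have hφ : φ.f = f := hφ
    have hψ : ψ.f = f' := hψ
    refine (hG.cover_mem_skeleton_iff _).1 (develop_mem_skeleton_iff.2 ?_)
    -- off the outer walls, points are glued only by `s 0` and `s 1`
    by_contra hx2
    refine hne (congrArg _ ?_)
    rw [← hφ, ← hψ]
    refine h.map_eq Flag.f fun i hi χ => ?_
    fin_cases i
    · exact hG.f_zero χ
    · exact hG.f_one χ
    · exact absurd hi hx2

theorem carrier_surface [T2Space X] (hG : K.IsCompatible G) : hG.surface.carrier = univ := by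
  refine eq_univ_of_forall fun y => Or.inr ?_
  obtain ⟨⟨φ, x⟩, rfl⟩ := G.proj_surjective y
  exact ⟨_, ⟨φ.f, φ.hf, rfl⟩, (φ, x), rfl, rfl⟩

theorem isSurface_surface [T2Space X] (hG : K.IsCompatible G) : hG.surface.IsSurface := by
  let H : hG.surface.carrier ≃ₜ G.Realization :=
    (Homeomorph.setCongr hG.carrier_surface).trans (Homeomorph.Set.univ _)
  intro y
  obtain ⟨U, hU, hyU, ⟨E⟩⟩ := G.exists_disk_nhd (H y)
  exact ⟨H ⁻¹' U, hU.preimage H.continuous, hyU, ⟨(H.sets rfl).trans E⟩⟩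

theorem isCellularMap_cover [T2Space X] (hG : K.IsCompatible G) :
    IsCellularMap hG.surface K hG.cover where
  continuousOn := hG.continuous_cover.continuousOn
  vertex _ hv := hv
  edge := by
    rintro _ ⟨φ, rfl⟩
    exact ⟨(hG.image_edgeCell φ).symm ▸ φ.he, hG.isEmbedding_edgeCell φ⟩
  face := by
    rintro _ ⟨f, hf, rfl⟩
    exact ⟨(hG.image_faceCell hf).symm ▸ hf, hG.isEmbedding_faceCell f⟩

theorem isEulerCover [T2Space X] (hG : K.IsCompatible G) (hK : K.IsCirclet) :
    IsEulerCover hG.surface K hG.cover where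
  isSurface := hG.isSurface_surface
  isConnected := by
    obtain ⟨f, hf⟩ := hK.2.1
    have : Nonempty K.Flag := ⟨(exists_flag_of_face hf).choose⟩
    rw [hG.carrier_surface]
    exact G.isConnected_univ (hG.joined_of_isCirclet hK)
  isCellularMap := hG.isCellularMap_cover
  existsUnique_face := by
    intro g hg
    refine ⟨faceCell G g, ⟨⟨g, hg, rfl⟩, hG.image_faceCell hg⟩, ?_⟩
    rintro _ ⟨⟨f, hf, rfl⟩, h⟩
    rw [hG.image_faceCell hf] at h
    rw [h]

end IsCompatible

end TwoComplex

/-- Every circlet has an Euler cover. -/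
theorem proposition3 {X : Type u} [TopologicalSpace X] [T2Space X] (K : TwoComplex X)
    (hK : K.IsCirclet) :
    ∃ (Y : Type u) (_ : TopologicalSpace Y) (_ : T2Space Y) (M : TwoComplex Y) (φ : Y → X),
      TwoComplex.IsEulerCover M K φ := by
  obtain ⟨G, hG⟩ := TwoComplex.exists_isCompatible hK.1
  exact ⟨G.Realization, inferInstance, inferInstance, hG.surface, hG.cover, hG.isEulerCover hK⟩
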